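/- **Setting.** Let $C$ be a CSS code on $n$ qubits with $X$-stabilizers $S^X_1,\dots,S^X_{n_x}$ and $Z$-stabilizers $S^Z_1,\dots,S^Z_{n_z}$ (commuting, not necessarily independent) such that $n_x+n_z=n$. Each stabilizer acts on a non-empty ordered list of distinct qubits $q_{a,1},\dots,q_{a,m_a}$ ($a$ indexes the stabilizer), and the $n$ first qubits $q_{a,1}$ are pairwise distinct. *Segment-hook errors.* An $X$-type segment-hook error is $\prod_{j=j_1}^{j_2}X_{q_{a,j}}$ with $a$ an $X$-stabilizer and $1\le j_1\le j_2\le m_a$; $Z$-type ones are defined in the same way with $Z$-stabilizers and Pauli $Z$. *Mid-SWAP cycle.* Each stabilizer $a$ has an ancilla wire. A cycle (1) puts fresh atoms on the ancilla wires, in state $|+\rangle$ for $X$-ancillas and $|0\rangle$ for $Z$-ancillas; (2) for every $X$-ancilla $a$ applies $CNOT(a,q_{a,1})$, $SWAP(a,q_{a,1})$, $CNOT(a,q_{a,2}),\dots,CNOT(a,q_{a,m_a})$ in this order; (3) then, for every $Z$-ancilla $a$, applies $CNOT(q_{a,1},a)$, $SWAP(q_{a,1},a)$, $CNOT(q_{a,2},a),\dots,CNOT(q_{a,m_a},a)$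 in this order; (4) destructively measures the $X$-ancillas in the $X$ basis and the $Z$-ancillas in the $Z$ basis. Inside phase (2) and inside phase (3) different ancillas may be interleaved arbitrarily. $SWAP$ is atom shuttling: the two atoms trade places. *Memory experiment.* For $b\in\{X,Z\}$ and $T\ge 0$: start in a state of the code space, run $T$ cycles, then destructively measure all data qubits in the basis $b$. *Atom loss.* A loss configuration is a finite set of space-time locations (a wire and a moment between consecutive operations). An atom present at such a location is lost; from then on every $CNOT$ acting on it is removed (shuttling still moves its place). Each measurement also reports whether the measured atom was lost (loss-resolving readout); if it was, its measurement bit is set to $0$. *Detectors and observables.* The detectors are the parities of consecutive reported values of the same stabilizer; the value before the first cycle is $0$, and for stabilizers of type $b$ a final value is computed from the data readout. A logical operator of type $b$ is a type-$b$ Pauli operator commuting with all stabilizers, nontrivial if it is not a product of stabilizers up to sign. If the initial state is an eigenvector of it with eigenvalue $(-1)^v$, its observable is the sum modulo $2$ of $v$ and of its value computed from the data readout. *Correction.* The experiment corrects $t$ atom losses with loss-resolving readouts if there is a deterministic decoder which, from the detector pattern and the loss-resolving readouts alone, predicts the observables of all type-$b$ logical operators correctly, for every initial code state (and all logical operators of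 which it is an eigenvector), every loss configuration with at most $t$ locations, and every measurement outcome of nonzero probability. **Theorem.** Let $d_s\ge 0$ be such that no product of at most $d_s$ $X$-type segment-hook errors, and no product of at most $d_s$ $Z$-type segment-hook errors, is a nontrivial logical operator. Then, for either basis $b\in\{X,Z\}$, every number $T$ of cycles and every allowed interleaving, the Mid-SWAP memory experiment corrects $d_s$ atom losses with loss-resolving readouts. -/

import Mathlib

open scoped Matrix

namespace MidSwap

/-! ### Circuits with atom loss

Qubits live on wires `W` (positions that hold one atom each); measurements carry labels in `M`.
Pure states are unnormalised amplitude functions on the computational basis; only the question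
whether a measurement branch has nonzero amplitude matters below. -/

/-- The two Pauli types; also the two single-qubit bases (of `X` and of `Z`). -/
inductive PauliType
  | X
  | Z
  deriving DecidableEq

/-- `(-1) ^ v` for a bit `v`. -/
def sign (v : ZMod 2) : ℂ := if v = 0 then 1 else -1

/-- Circuit operations. -/
inductive Op (W M : Type)
  /-- put a fresh atom on an empty wire, in the state `|+⟩` (type `X`) or `|0⟩` (type `Z`) -/
  | prep (b : PauliType) (w : W)
  /-- the gate `CNOT(control, target)` -/
  | cnot (control target : W)
  /-- atom shuttling: the atoms on the two wires trade places, each taking its state along -/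
  | swap (u v : W)
  /-- destructive loss-resolving measurement in the `X` or `Z` basis; the atom is discarded -/
  | meas (b : PauliType) (w : W) (label : M)

/-- The situation during a run of a circuit. -/
structure Config (W M : Type) where
  /-- the wires whose atom has been lost -/
  lost : W → Bool
  /-- the loss-resolving readouts made so far: was the measured atom lost? -/
  readout : M → Bool
  /-- amplitudes of the current branch; an empty wire is represented by `|0⟩` -/
  amp : (W → ZMod 2) → ℂ

section Semantics

variable {W M : Type} [DecidableEq W] [DecidableEq M]

/-- One operation, in the branch in which measurement `κ` projects onto the basis vector number
`o κ`. Atom loss removes gates: a `CNOT` that involves a lost atom is not applied. The qubit of a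
lost atom just stays out of all further interaction; projecting it in the end amounts to tracing
it out, because its outcome is not reported (see `visible`). -/
def step (o : M → ZMod 2) (g : Op W M) (s : Config W M) : Config W M :=
  match g with
  | .prep .Z w => { s with lost := Function.update s.lost w false }
  | .prep .X w =>
      { s with
        lost := Function.update s.lost w false
        amp := fun x => s.amp (Function.update x w 0) }
  | .cnot c t =>
      if s.lost c || s.lost t then s
      else { s with amp := fun x => s.amp (Function.update x t (x t + x c)) }
  | .swap u v =>
      { s with
        lost := fun w => s.lost (Equiv.swap u v w)
        amp := fun x => s.amp (fun w => x (Equiv.swap u v w)) }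
  | .meas .Z w κ =>
      { s with
        readout := Function.update s.readout κ (s.lost w)
        amp := fun x => if x w = 0 then s.amp (Function.update x w (o κ)) else 0 }
  | .meas .X w κ =>
      { s with
        readout := Function.update s.readout κ (s.lost w)
        amp := fun x =>
          if x w = 0 then ∑ y : ZMod 2, sign (o κ * y) * s.amp (Function.update x w y) else 0 }

/-- The atoms lost just before operation number `k`, for the loss configuration `L`
(a finite set of space-time locations). -/
def lose (L : Finset (ℕ × W)) (k : ℕ) (s : Config W M) : Config W M :=
  { s with lost := fun w => s.lost w || decide ((k, w) ∈ L) }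

/-- Run a circuit whose first operation has number `k`, with loss configuration `L`, in the
branch given by `o`. -/
def exec (L : Finset (ℕ × W)) (o : M → ZMod 2) : ℕ → List (Op W M) → Config W M → Config W M
  | _, [], s => s
  | k, g :: gs, s => exec L o (k + 1) gs (step o g (lose L k s))

/-- The reported bits: the measurement outcome if the atom was present, and the placeholder `0`
if it was found to be lost. -/
def visible (readout : M → Bool) (o : M → ZMod 2) (κ : M) : ZMod 2 :=
  if readout κ then 0 else o κ

end Semantics

/-! ### CSS codes -/

/-- The indicator vector of the qubits `q k`, `k ∈ s`. -/
def qubitVec {m n : ℕ} (q : Fin m → Fin n) (s : Finset (Fin m)) : Fin n → ZMod 2 :=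
  ∑ k ∈ s, Pi.single (q k) 1

/-- A CSS code on `n` qubits with `nx` `X`-stabilizers (indices `Sum.inl i`) and `nz`
`Z`-stabilizers (indices `Sum.inr j`), not necessarily independent, with ordered supports, such
that `nx + nz = n` and the first qubits of the stabilizers are distinct. -/
structure CSSCode (n nx nz : ℕ) where
  /-- number of qubits on which a stabilizer acts -/
  weight : Fin nx ⊕ Fin nz → ℕ
  weight_pos : ∀ a, 0 < weight a
  /-- the qubits on which a stabilizer acts, in order -/
  qubit : (a : Fin nx ⊕ Fin nz) → Fin (weight a) → Fin n
  qubit_injective : ∀ a, Function.Injective (qubit a)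
  commute : ∀ i j, qubitVec (qubit (Sum.inl i)) Finset.univ ⬝ᵥ
    qubitVec (qubit (Sum.inr j)) Finset.univ = 0
  card_add : nx + nz = n
  first_injective : Function.Injective fun a => qubit a ⟨0, weight_pos a⟩

/-- The type of a stabilizer, and of the ancilla that measures it. -/
def kind {nx nz : ℕ} : Fin nx ⊕ Fin nz → PauliType
  | Sum.inl _ => .X
  | Sum.inr _ => .Z

/-- The Pauli operator of type `b` supported on `u`, acting on `n`-qubit states. -/
def pauli {n : ℕ} (b : PauliType) (u : Fin n → ZMod 2) (ψ : (Fin n → ZMod 2) → ℂ) :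
    (Fin n → ZMod 2) → ℂ :=
  match b with
  | .X => fun x => ψ (x + u)
  | .Z => fun x => sign (u ⬝ᵥ x) * ψ x

namespace CSSCode

variable {n nx nz : ℕ} (C : CSSCode n nx nz)

/-- The support of a stabilizer as a vector over `𝔽₂`. -/
def stab (a : Fin nx ⊕ Fin nz) : Fin n → ZMod 2 := qubitVec (C.qubit a) Finset.univ

/-- The type-`b` Pauli operator supported on `u` commutes with all stabilizers, i.e. it is a
(possibly trivial) logical operator. -/
def IsLogical (b : PauliType) (u : Fin n → ZMod 2) : Prop :=
  ∀ a, kind a ≠ b → u ⬝ᵥ C.stab a = 0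

/-- The type-`b` Pauli operator supported on `u` is a product of stabilizers. -/
def IsStabilizer (b : PauliType) (u : Fin n → ZMod 2) : Prop :=
  u ∈ Submodule.span (ZMod 2) {v | ∃ a, kind a = b ∧ v = C.stab a}

/-- Segment-hook errors of type `b`: type-`b` Pauli operators on a contiguous segment
`q_{j₁}, …, q_{j₂}` of the ordered support of a type-`b` stabilizer. -/
def IsSegmentHook (b : PauliType) (u : Fin n → ZMod 2) : Prop :=
  ∃ (a : Fin nx ⊕ Fin nz) (j₁ j₂ : Fin (C.weight a)),
    kind a = b ∧ j₁ ≤ j₂ ∧ u = qubitVec (C.qubit a) (Finset.Icc j₁ j₂)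

/-- No product of at most `d` segment-hook errors of the same type is a nontrivial logical
operator. -/
def SegmentHooksTrivial (d : ℕ) : Prop :=
  ∀ (b : PauliType) (s : List (Fin n → ZMod 2)), s.length ≤ d →
    (∀ u ∈ s, C.IsSegmentHook b u) → C.IsLogical b s.sum → C.IsStabilizer b s.sum

/-- States in the code space. -/
def IsCodeState (ψ : (Fin n → ZMod 2) → ℂ) : Prop :=
  ∀ a, pauli (kind a) (C.stab a) ψ = ψ

/-! ### The Mid-SWAP syndrome extraction circuit -/

/-- Wires: `n` data wires and one ancilla wire per stabilizer. -/
abbrev Wire (n nx nz : ℕ) : Type := Fin n ⊕ (Fin nx ⊕ Fin nz)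

/-- Measurements: one per cycle and ancilla, and the final readout of the data qubits. -/
abbrev Label (n nx nz T : ℕ) : Type := (Fin T × (Fin nx ⊕ Fin nz)) ⊕ Fin n

/-- An order of execution of the `CNOT`s inside the `X` phase and inside the `Z` phase of a
cycle. The entry `⟨a, k⟩` stands for the interaction of ancilla `a` with its qubit number `k`.
Different ancillas may be interleaved at will; each ancilla meets its qubits in their order
(`ordered` also excludes repetitions). -/
structure Schedule where
  order : PauliType → List (Σ a : Fin nx ⊕ Fin nz, Fin (C.weight a))
  mem_order : ∀ b p, p ∈ order b ↔ kind p.1 = b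
  ordered : ∀ b, (order b).Pairwise fun p r => p.1 = r.1 → p.2.val < r.2.val

variable {C}

/-- The `CNOT` between ancilla `p.1` and its qubit number `p.2`, followed by a `SWAP` of the
two if it is the ancilla's first one. -/
def gate {T : ℕ} (p : Σ a : Fin nx ⊕ Fin nz, Fin (C.weight a)) :
    List (Op (Wire n nx nz) (Label n nx nz T)) :=
  let anc : Wire n nx nz := Sum.inr p.1
  let dat : Wire n nx nz := Sum.inl (C.qubit p.1 p.2)
  (match kind p.1 with
    | .X => Op.cnot anc dat
    | .Z => Op.cnot dat anc) ::
  (if p.2.val = 0 then [Op.swap anc dat] else [])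

/-- All ancillas. -/
def ancillas (nx nz : ℕ) : List (Fin nx ⊕ Fin nz) :=
  (List.finRange nx).map Sum.inl ++ (List.finRange nz).map Sum.inr

/-- Syndrome extraction cycle number `c`: fresh ancillas, `X` phase, `Z` phase, measurement of
the ancilla wires. -/
def cycle (σ : C.Schedule) {T : ℕ} (c : Fin T) :
    List (Op (Wire n nx nz) (Label n nx nz T)) :=
  (ancillas nx nz).map (fun a => Op.prep (kind a) (Sum.inr a)) ++
  (σ.order .X).flatMap gate ++
  (σ.order .Z).flatMap gate ++
  (ancillas nx nz).map (fun a => Op.meas (kind a) (Sum.inr a) (Sum.inl (c, a)))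

/-- The memory experiment: `T` cycles, then all data qubits are measured in basis `b`. -/
def memory (σ : C.Schedule) (b : PauliType) (T : ℕ) :
    List (Op (Wire n nx nz) (Label n nx nz T)) :=
  (List.finRange T).flatMap (cycle σ) ++
  (List.finRange n).map (fun q => Op.meas b (Sum.inl q) (Sum.inr q))

/-- The data wires are in state `ψ`, the ancilla wires are empty, nothing is lost. -/
def initial (nx nz T : ℕ) (ψ : (Fin n → ZMod 2) → ℂ) :
    Config (Wire n nx nz) (Label n nx nz T) where
  lost := fun _ => false
  readout := fun _ => false
  amp := fun x => if ∀ a, x (Sum.inr a) = 0 then ψ (fun q => x (Sum.inl q)) else 0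

/-- The memory experiment on input `ψ` with loss configuration `L`, in branch `o`. -/
def run (σ : C.Schedule) (b : PauliType) (T : ℕ) (ψ : (Fin n → ZMod 2) → ℂ)
    (L : Finset (ℕ × Wire n nx nz)) (o : Label n nx nz T → ZMod 2) :
    Config (Wire n nx nz) (Label n nx nz T) :=
  exec L o 0 (memory σ b T) (initial nx nz T ψ)

/-! ### Detectors, observables, decoding -/

/-- The value reported for stabilizer `a` by the `r`-th cycle, `1 ≤ r ≤ T`; it is `0` for
`r = 0`, since the initial state lies in the code space. -/
def syndrome {T : ℕ} (y : Label n nx nz T → ZMod 2) (r : ℕ) (a : Fin nx ⊕ Fin nz) : ZMod 2 :=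
  match r with
  | 0 => 0
  | c + 1 => if h : c < T then y (Sum.inl (⟨c, h⟩, a)) else 0

/-- Detector patterns: one detector per cycle and stabilizer, and one final detector per
stabilizer of the type of the final data readout. -/
abbrev Pattern (nx nz T : ℕ) (b : PauliType) : Type :=
  (Fin T → Fin nx ⊕ Fin nz → ZMod 2) × ({a : Fin nx ⊕ Fin nz // kind a = b} → ZMod 2)

variable (C) in
/-- The detectors, evaluated on the reported bits `y`: the parities of consecutive values of the
same stabilizer, where the final value is computed from the readout of the data qubits. -/
def detectors (b : PauliType) {T : ℕ} (y : Label n nx nz T → ZMod 2) : Pattern nx nz T b :=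
  (fun c a => syndrome y (c.val + 1) a + syndrome y c.val a,
   fun a => (C.stab a.1 ⬝ᵥ fun q => y (Sum.inr q)) + syndrome y T a.1)

/-- The measured value of the logical operator `u`, from the reported bits `y`. -/
def observable {T : ℕ} (y : Label n nx nz T → ZMod 2) (u : Fin n → ZMod 2) : ZMod 2 :=
  u ⬝ᵥ fun q => y (Sum.inr q)

/-- The memory experiment corrects `t` atom losses with loss-resolving readouts: some decoder,
given the detector pattern and the loss-resolving readouts only, predicts for every loss
configuration of at most `t` losses and every possible measurement outcome which logical
operators `u` of type `b` have a measured value that differs from their value `v` in the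
initial code state. -/
def CorrectsLosses (σ : C.Schedule) (b : PauliType) (T t : ℕ) : Prop :=
  ∃ dec : Pattern nx nz T b → (Label n nx nz T → Bool) → (Fin n → ZMod 2) → ZMod 2,
    ∀ ψ : (Fin n → ZMod 2) → ℂ, C.IsCodeState ψ →
    ∀ L : Finset (ℕ × Wire n nx nz), L.card ≤ t →
    ∀ o : Label n nx nz T → ZMod 2, (run σ b T ψ L o).amp ≠ 0 →
    ∀ (u : Fin n → ZMod 2) (v : ZMod 2), C.IsLogical b u → pauli b u ψ = sign v • ψ →
      let r := (run σ b T ψ L o).readout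
      let y := visible r o
      dec (C.detectors b y) r u = observable y u + v

end CSSCode

end MidSwap

namespace MidSwap

/-! ### Signs and Fourier transforms over `𝔽₂` -/

/-! Fix the basis `b` of the final readout and write states in that basis (for `X`, by a Fourier
transform over `𝔽₂`). There every operation acts on bit strings, so a branch of nonzero amplitude
contains a classical trajectory from a string in the support of the initial state to the end of the
circuit (`exists_path`). Pauli operators of the type opposite to `b` are the bit flips in this
picture.

Along a trajectory, each ancilla changes the data in a controlled way. After the SWAP its wire holds
the old data atom. For an ancilla of type `b` this atom only collects parities, and the data keep
their values. For the other type it has some bit `r`, and `r` times the initial segment of the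
support met so far has been added to the data; at the end this is a multiple of a stabilizer. If the
atom is lost, the remaining gates vanish and the effect is frozen at an initial segment; a loss
before the SWAP damages at most the first qubit. The loss shows up when that atom is measured. Hence
the data readout is a string of the initial state, plus stabilizers of the opposite type, plus one
error per flagged measurement (`run_effect`), and there are at most as many flags as loss locations
(`card_readout_exec_le`).

Now compare two runs with equal detectors and equal loss readouts. At each flag the two errors
differ by a difference of initial segments of the same stabilizer, which is a segment hook or zero,
or by a single-qubit flip. Equal final syndromes make the total difference `E` commute with the
stabilizers of type `b`. A single-qubit flip might lie outside all stabilizers of the opposite type.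
But `nx + nz = n` makes every qubit a first qubit, so such a qubit starts a stabilizer of type `b`;
the type-`b` Pauli on it is then a segment hook and a logical operator, hence a stabilizer, so `E`
vanishes there (`restrict_eq_self`). Thus `E` is a product of at most `ds` segment hooks and, by
hypothesis, a stabilizer, so it changes no observable. The prediction is therefore determined by the
decoder's input. -/

theorem zmod_two_cases (a : ZMod 2) : a = 0 ∨ a = 1 := by
  revert a; decide

theorem sign_add (a b : ZMod 2) : sign (a + b) = sign a * sign b := by
  have h11 : (1 : ZMod 2) + 1 = 0 := by decide
  rcases zmod_two_cases a with rfl | rfl <;> rcases zmod_two_cases b with rfl | rfl <;>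
    simp [sign, h11]

theorem sign_mul_self (a : ZMod 2) : sign a * sign a = 1 := by
  rcases zmod_two_cases a with rfl | rfl <;> simp [sign]

theorem sign_zero : sign 0 = 1 := by simp [sign]

theorem sign_one : sign 1 = -1 := by simp [sign]

theorem eq_of_sign_mul_eq {a v : ZMod 2} {z : ℂ} (hz : z ≠ 0) (h : sign a * z = sign v * z) :
    a = v := by
  have h' := mul_right_cancel₀ hz h
  rcases zmod_two_cases a with rfl | rfl <;> rcases zmod_two_cases v with rfl | rfl <;>
    first
      | rfl
      | norm_num [sign] at h'

section Circuits

variable {W M : Type} [DecidableEq W]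

theorem dotProduct_update [Fintype W] (p y : W → ZMod 2) (w : W) (z : ZMod 2) :
    p ⬝ᵥ Function.update y w z = p ⬝ᵥ y + p w * (z + y w) := by
  have : Function.update y w z = y + Pi.single w (z + y w) := by
    ext i
    by_cases hi : i = w
    · subst hi
      simp only [Function.update_self, Pi.add_apply, Pi.single_eq_same]
      rw [add_comm z, ← add_assoc, CharTwo.add_self_eq_zero, zero_add]
    · simp [hi]
  rw [this, dotProduct_add, dotProduct_single]

theorem update_dotProduct [Fintype W] (p y : W → ZMod 2) (w : W) (z : ZMod 2) :
    Function.update p w z ⬝ᵥ y = p ⬝ᵥ y + (z + p w) * y w := by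
  rw [dotProduct_comm, dotProduct_update, dotProduct_comm, mul_comm]

/-- Summation over one coordinate first. -/
theorem sum_eq_sum_update [Fintype W] (w : W) (f : (W → ZMod 2) → ℂ) :
    ∑ y, f y = ∑ y : W → ZMod 2,
      if y w = 0 then ∑ z : ZMod 2, f (Function.update y w z) else 0 := by
  have h (z : ZMod 2) : ∑ y : W → ZMod 2, (if y w = z then f y else 0) =
      ∑ y : W → ZMod 2, if y w = 0 then f (Function.update y w z) else 0 := by
    rw [← Finset.sum_filter, ← Finset.sum_filter]
    refine Finset.sum_bij' (fun y _ => Function.update y w 0)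
      (fun y _ => Function.update y w z) ?_ ?_ ?_ ?_ ?_
    · intro y _; simp
    · intro y _; simp
    · intro y hy
      simp only [Finset.mem_filter, Finset.mem_univ, true_and] at hy
      simp [← hy]
    · intro y hy
      simp only [Finset.mem_filter, Finset.mem_univ, true_and] at hy
      simp [← hy]
    · intro y hy
      simp only [Finset.mem_filter, Finset.mem_univ, true_and] at hy
      simp [← hy]
  calc ∑ y, f y = ∑ y : W → ZMod 2, ∑ z : ZMod 2, if y w = z then f y else 0 := by
        simp
    _ = ∑ z : ZMod 2, ∑ y : W → ZMod 2, if y w = z then f y else 0 := Finset.sum_comm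
    _ = ∑ z : ZMod 2, ∑ y : W → ZMod 2,
          if y w = 0 then f (Function.update y w z) else 0 := by simp only [h]
    _ = _ := by
        rw [Finset.sum_comm]
        refine Finset.sum_congr rfl fun y _ => ?_
        split_ifs <;> simp

/-- Amplitudes in the basis of type `b`. -/
def spectrum [Fintype W] (b : PauliType) (f : (W → ZMod 2) → ℂ) : (W → ZMod 2) → ℂ :=
  match b with
  | .Z => f
  | .X => fun p => ∑ x, sign (p ⬝ᵥ x) * f x

theorem sum_zmod_two (f : ZMod 2 → ℂ) : ∑ z, f z = f 0 + f 1 := Fin.sum_univ_two f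

theorem spectrum_X_split [Fintype W] (f : (W → ZMod 2) → ℂ) (w : W) (p : W → ZMod 2) :
    spectrum .X f p = ∑ y : W → ZMod 2, if y w = 0 then
      sign (p ⬝ᵥ y) * ∑ z, sign (p w * z) * f (Function.update y w z) else 0 := by
  unfold spectrum
  simp only
  rw [sum_eq_sum_update w]
  refine Finset.sum_congr rfl fun y _ => ?_
  split_ifs with hy
  · rw [Finset.mul_sum]
    refine Finset.sum_congr rfl fun z _ => ?_
    rw [dotProduct_update, hy, add_zero, sign_add, mul_assoc]
  · rfl

/-- For `X` this is injectivity of the Fourier transform. -/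
theorem exists_spectrum_ne_zero [Fintype W] (b : PauliType) {f : (W → ZMod 2) → ℂ}
    (hf : f ≠ 0) : ∃ x, spectrum b f x ≠ 0 := by
  obtain ⟨x₀, hx₀⟩ := Function.ne_iff.mp hf
  cases b with
  | Z => exact ⟨x₀, hx₀⟩
  | X =>
    by_contra! hall
    apply hx₀
    have h1 : ∑ p : W → ZMod 2, sign (p ⬝ᵥ x₀) * spectrum .X f p = 0 := by simp [hall]
    unfold spectrum at h1
    simp only [Finset.mul_sum] at h1
    rw [Finset.sum_comm] at h1
    have h2 : ∀ x : W → ZMod 2, x ≠ x₀ →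
        -- The terms for `p` and for `p` flipped at a coordinate where `x` and `x₀` differ cancel.
        ∑ p : W → ZMod 2, sign (p ⬝ᵥ x₀) * (sign (p ⬝ᵥ x) * f x) = 0 := by
      intro x hx
      obtain ⟨w, hw⟩ := Function.ne_iff.mp hx
      rw [sum_eq_sum_update w]
      refine Finset.sum_eq_zero fun p _ => ?_
      split_ifs with hp
      · rw [sum_zmod_two]
        simp only [update_dotProduct, hp, add_zero, zero_mul, one_mul, sign_add]
        have : sign (x₀ w) * sign (x w) = -1 := by
          rcases zmod_two_cases (x w) with h | h <;> rcases zmod_two_cases (x₀ w) with h' | h' <;>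
            simp_all [sign]
        linear_combination (sign (p ⬝ᵥ x₀) * sign (p ⬝ᵥ x) * f x) * this
      · rfl
    rw [Finset.sum_eq_single x₀ (fun x _ hx => h2 x hx) (by simp)] at h1
    simp only [← mul_assoc, sign_mul_self, one_mul, Finset.sum_const, nsmul_eq_mul] at h1
    rcases mul_eq_zero.mp h1 with h | h
    · exact absurd h (Nat.cast_ne_zero.mpr (Finset.card_ne_zero.mpr Finset.univ_nonempty))
    · exact h

/-! ### Occupied wires -/

/-- The wires that hold an atom after an operation. -/
def occupiedAfter (occ : W → Bool) : Op W M → W → Bool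
  | .prep _ w => Function.update occ w true
  | .cnot _ _ => occ
  | .swap _ _ => occ
  | .meas _ w _ => Function.update occ w false

/-- An operation acts on the right kind of wires: preparation on an empty one, everything else on
occupied ones. -/
def Admissible (occ : W → Bool) : Op W M → Prop
  | .prep _ w => occ w = false
  | .cnot c t => c ≠ t ∧ occ c = true ∧ occ t = true
  | .swap u v => occ u = true ∧ occ v = true
  | .meas _ w _ => occ w = true

/-- All operations of a circuit are admissible. -/
def WellFormed : (W → Bool) → List (Op W M) → Prop
  | _, [] => True
  | occ, g :: gs => Admissible occ g ∧ WellFormed (occupiedAfter occ g) gs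

theorem wellFormed_append (occ : W → Bool) (l₁ l₂ : List (Op W M)) :
    WellFormed occ (l₁ ++ l₂) ↔
      WellFormed occ l₁ ∧ WellFormed (l₁.foldl occupiedAfter occ) l₂ := by
  induction l₁ generalizing occ with
  | nil => simp [WellFormed]
  | cons g l ih => simp [WellFormed, ih, and_assoc]

/-- The number of atoms that have been lost: those found to be lost by a measurement, and those
still on an occupied wire. -/
def lostCount [Fintype W] [Fintype M] (occ : W → Bool) (s : Config W M) : ℕ :=
  (Finset.univ.filter fun κ => s.readout κ = true).card +
    (Finset.univ.filter fun w => occ w = true ∧ s.lost w = true).card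

theorem lostCount_lose_le [Fintype W] [Fintype M] (occ : W → Bool) (L : Finset (ℕ × W)) (k : ℕ) (s : Config W M) :
    lostCount occ (lose L k s) ≤ lostCount occ s + (L.filter fun p => p.1 = k).card := by
  unfold lostCount
  rw [Nat.add_assoc]
  refine Nat.add_le_add_left ?_ _
  calc _ ≤ ((Finset.univ.filter fun w => occ w = true ∧ s.lost w = true) ∪
          (L.filter fun p => p.1 = k).image Prod.snd).card := by
        refine Finset.card_le_card fun w hw => ?_
        simp only [lose, Finset.mem_filter, Finset.mem_univ, true_and, Bool.or_eq_true,
          decide_eq_true_eq] at hw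
        simp only [Finset.mem_union, Finset.mem_filter, Finset.mem_univ, true_and,
          Finset.mem_image]
        rcases hw.2 with h | h
        · exact Or.inl ⟨hw.1, h⟩
        · exact Or.inr ⟨(k, w), ⟨h, rfl⟩, rfl⟩
    _ ≤ _ := (Finset.card_union_le _ _).trans (Nat.add_le_add_left Finset.card_image_le _)

variable [DecidableEq M]

/-- Empty wires are in state `|0⟩`. -/
def EmptyZero (occ : W → Bool) (f : (W → ZMod 2) → ℂ) : Prop :=
  ∀ x, f x ≠ 0 → ∀ w, occ w = false → x w = 0

theorem EmptyZero.step {occ : W → Bool} {s : Config W M} (h : EmptyZero occ s.amp)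
    (o : M → ZMod 2) (g : Op W M) (hg : Admissible occ g) :
    EmptyZero (occupiedAfter occ g) (step o g s).amp := by
  intro x hx w hw
  cases g with
  | prep b v =>
    have hwv : w ≠ v := by rintro rfl; simp [occupiedAfter] at hw
    have hw' : occ w = false := by simpa [occupiedAfter, hwv] using hw
    cases b with
    | X => simpa [hwv] using h _ hx w hw'
    | Z => exact h _ hx w hw'
  | cnot c t =>
    have hwt : w ≠ t := by rintro rfl; simp_all [occupiedAfter, Admissible]
    by_cases hl : (s.lost c || s.lost t) = true
    · simp only [MidSwap.step, hl, if_true] at hx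
      exact h _ hx w hw
    · simp only [MidSwap.step, hl] at hx
      simpa [hwt] using h _ hx w hw
  | swap u v =>
    have hwu : w ≠ u := by rintro rfl; simp_all [occupiedAfter, Admissible]
    have hwv : w ≠ v := by rintro rfl; simp_all [occupiedAfter, Admissible]
    simpa [Equiv.swap_apply_of_ne_of_ne hwu hwv] using h _ hx w hw
  | meas b v κ =>
    have hxv : x v = 0 := by
      by_contra hne
      cases b <;> simp [MidSwap.step, hne] at hx
    by_cases hwv : w = v
    · rw [hwv, hxv]
    have hw' : occ w = false := by simpa [occupiedAfter, hwv] using hw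
    cases b with
    | X =>
      simp only [MidSwap.step, hxv, if_true] at hx
      obtain ⟨y, -, hy⟩ := Finset.exists_ne_zero_of_sum_ne_zero hx
      simpa [hwv] using h _ (right_ne_zero_of_mul hy) w hw'
    | Z =>
      simp only [MidSwap.step, hxv, if_true] at hx
      simpa [hwv] using h _ hx w hw'

/-! ### Classical trajectories -/

/-- The possible transitions of the bit values of the wires in the basis of type `b`. -/
def Flow (b : PauliType) (o : M → ZMod 2) (lost : W → Bool) (g : Op W M)
    (x x' : W → ZMod 2) : Prop :=
  match g with
  | .prep b' w => (∀ v, v ≠ w → x' v = x v) ∧ (b' = b → x' w = 0)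
  | .cnot c t => x' = if lost c || lost t then x else
      match b with
      | .Z => Function.update x t (x t + x c)
      | .X => Function.update x c (x c + x t)
  | .swap u v => x' = fun w => x (Equiv.swap u v w)
  | .meas b' w κ => (∀ v, v ≠ w → x' v = x v) ∧ (b' = b → x w = o κ)

theorem exists_flow_Z [Fintype W] {occ : W → Bool} {s : Config W M} (h : EmptyZero occ s.amp)
    (o : M → ZMod 2) (g : Op W M) (hg : Admissible occ g) {x' : W → ZMod 2}
    (hx' : (step o g s).amp x' ≠ 0) :
    ∃ x, s.amp x ≠ 0 ∧ Flow .Z o s.lost g x x' := by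
  cases g with
  | prep b w =>
    cases b with
    | X => exact ⟨_, hx', fun v hv => by simp [hv], by simp⟩
    | Z => exact ⟨_, hx', fun v hv => rfl, fun _ => h _ hx' w hg⟩
  | cnot c t =>
    by_cases hl : (s.lost c || s.lost t) = true
    · simp only [step, hl, if_true] at hx'
      exact ⟨_, hx', by simp [Flow, hl]⟩
    · simp only [step, hl] at hx'
      refine ⟨_, hx', ?_⟩
      simp [Flow, hl, hg.1, add_assoc, CharTwo.add_self_eq_zero]
  | swap u v =>
    exact ⟨_, hx', by simp [Flow]⟩
  | meas b w κ =>
    have hxw : x' w = 0 := by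
      by_contra hne
      cases b <;> simp [step, hne] at hx'
    cases b with
    | X =>
      simp only [step, hxw, if_true] at hx'
      obtain ⟨y, -, hy⟩ := Finset.exists_ne_zero_of_sum_ne_zero hx'
      exact ⟨_, right_ne_zero_of_mul hy, fun v hv => by simp [hv], by simp⟩
    | Z =>
      simp only [step, hxw, if_true] at hx'
      exact ⟨_, hx', fun v hv => by simp [hv], by simp⟩

/-- The factor `1 + sign (p w)` vanishes for `p w = 1`: a fresh `|+⟩` has bit `0` in the `X` basis.
-/
theorem spectrum_prep_X [Fintype W] {occ : W → Bool} {f : (W → ZMod 2) → ℂ}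
    (h : EmptyZero occ f) {w : W} (hw : occ w = false) (p : W → ZMod 2) :
    spectrum .X (fun x => f (Function.update x w 0)) p =
      (1 + sign (p w)) * spectrum .X f p := by
  rw [spectrum_X_split _ w, spectrum_X_split f w, Finset.mul_sum]
  refine Finset.sum_congr rfl fun y _ => ?_
  split_ifs with hy
  · have h1 : f (Function.update y w 1) = 0 := by
      by_contra hne
      simpa using h _ hne w hw
    simp only [sum_zmod_two, h1, Function.update_idem, mul_zero, sign_zero, mul_one]
    ring
  · simp

/-- In the `X` basis, control and target exchange roles. -/
theorem spectrum_cnot_X [Fintype W] (f : (W → ZMod 2) → ℂ) {c t : W} (hct : c ≠ t)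
    (p : W → ZMod 2) :
    spectrum .X (fun x => f (Function.update x t (x t + x c))) p =
      spectrum .X f (Function.update p c (p c + p t)) := by
  unfold spectrum
  simp only
  have hinv : Function.Involutive fun x : W → ZMod 2 => Function.update x t (x t + x c) := by
    intro x
    simp [hct, add_assoc, CharTwo.add_self_eq_zero]
  rw [← Equiv.sum_comp hinv.toPerm]
  refine Finset.sum_congr rfl fun x _ => ?_
  simp only [Function.Involutive.coe_toPerm]
  have hx : Function.update (Function.update x t (x t + x c)) t
      (Function.update x t (x t + x c) t + Function.update x t (x t + x c) c) = x := hinv x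
  rw [hx, dotProduct_update, update_dotProduct]
  congr 3
  rw [add_right_comm, CharTwo.add_self_eq_zero, add_right_comm, CharTwo.add_self_eq_zero]
  ring

theorem spectrum_swap_X [Fintype W] (f : (W → ZMod 2) → ℂ) (e : Equiv.Perm W)
    (p : W → ZMod 2) :
    spectrum .X (fun x => f (fun w => x (e w))) p = spectrum .X f (fun w => p (e w)) := by
  unfold spectrum
  simp only
  rw [← Equiv.sum_comp (Equiv.arrowCongr e (Equiv.refl (ZMod 2)))]
  refine Finset.sum_congr rfl fun x _ => ?_
  have h1 : (fun w => (Equiv.arrowCongr e (Equiv.refl (ZMod 2))) x (e w)) = x := by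
    ext w; simp [Equiv.arrowCongr]
  rw [h1]
  congr 2
  simp only [dotProduct]
  rw [← Equiv.sum_comp e]
  simp [Equiv.arrowCongr]

theorem exists_flow_X [Fintype W] {occ : W → Bool} {s : Config W M} (h : EmptyZero occ s.amp)
    (o : M → ZMod 2) (g : Op W M) (hg : Admissible occ g) {x' : W → ZMod 2}
    (hx' : spectrum .X (step o g s).amp x' ≠ 0) :
    ∃ x, spectrum .X s.amp x ≠ 0 ∧ Flow .X o s.lost g x x' := by
  cases g with
  | prep b w =>
    cases b with
    | Z => exact ⟨_, hx', fun v hv => rfl, by simp⟩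
    | X =>
      simp only [step] at hx'
      rw [spectrum_prep_X h hg] at hx'
      refine ⟨x', right_ne_zero_of_mul hx', fun v hv => rfl, fun _ => ?_⟩
      rcases zmod_two_cases (x' w) with h0 | h1
      · exact h0
      · exact absurd (by simp [h1, sign_one]) (left_ne_zero_of_mul hx')
  | cnot c t =>
    by_cases hl : (s.lost c || s.lost t) = true
    · simp only [step, hl, if_true] at hx'
      exact ⟨_, hx', by simp [Flow, hl]⟩
    · simp only [step, hl] at hx'
      rw [if_neg (by simp), spectrum_cnot_X _ hg.1] at hx'
      refine ⟨_, hx', ?_⟩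
      simp [Flow, hl, hg.1.symm, add_assoc, CharTwo.add_self_eq_zero]
  | swap u v =>
    simp only [step] at hx'
    rw [spectrum_swap_X ] at hx'
    exact ⟨_, hx', by simp [Flow]⟩
  | meas b w κ =>
    cases b with
    | X =>
      refine ⟨Function.update x' w (o κ), ?_, fun v hv => by simp [hv], by simp⟩
      convert hx' using 1
      rw [spectrum_X_split _ w, spectrum]
      refine Finset.sum_congr rfl fun y _ => ?_
      simp only [step]
      split_ifs with hy
      · simp [update_dotProduct, hy]
      · simp
    | Z =>
      by_contra! hall
      have hz (z : ZMod 2) : spectrum .X s.amp (Function.update x' w z) = 0 := by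
        by_contra hne
        exact hall _ hne ⟨fun v hv => by simp [hv], by simp⟩
      -- Projecting onto a `Z` outcome superposes both `X` values of the wire: the combination keeps
      -- only the amplitude at `o κ`, counted twice. One of the two values must therefore be a
      -- predecessor.
      have key : sign (0 * o κ) * spectrum .X s.amp (Function.update x' w 0) +
          sign (1 * o κ) * spectrum .X s.amp (Function.update x' w 1) =
          2 * spectrum .X (step o (.meas .Z w κ) s).amp x' := by
        rw [spectrum_X_split _ w, spectrum_X_split s.amp w (Function.update x' w 1), spectrum,
          Finset.mul_sum, Finset.mul_sum, Finset.mul_sum, ← Finset.sum_add_distrib]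
        refine Finset.sum_congr rfl fun y _ => ?_
        simp only [step]
        split_ifs with hy
        · rcases zmod_two_cases (o κ) with ho | ho <;>
            simp [update_dotProduct, hy, ho, sum_zmod_two, sign_zero, sign_one] <;> ring
        · simp
      rw [hz, hz] at key
      apply hx'
      have := key.symm
      simpa using this

theorem exists_flow [Fintype W] (b : PauliType) {occ : W → Bool} {s : Config W M}
    (h : EmptyZero occ s.amp) (o : M → ZMod 2) (g : Op W M) (hg : Admissible occ g)
    {x' : W → ZMod 2} (hx' : spectrum b (step o g s).amp x' ≠ 0) :
    ∃ x, spectrum b s.amp x ≠ 0 ∧ Flow b o s.lost g x x' := by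
  cases b with
  | X => exact exists_flow_X h o g hg hx'
  | Z => exact exists_flow_Z h o g hg hx'

/-- Trajectories of bit values through a circuit. -/
def Path (b : PauliType) (L : Finset (ℕ × W)) (o : M → ZMod 2) :
    ℕ → List (Op W M) → Config W M → (W → ZMod 2) → (W → ZMod 2) → Prop
  | _, [], _, x, x' => x' = x
  | k, g :: gs, s, x, x' => ∃ y, Flow b o (lose L k s).lost g x y ∧
      Path b L o (k + 1) gs (step o g (lose L k s)) y x'

theorem exec_append (L : Finset (ℕ × W)) (o : M → ZMod 2) (k : ℕ) (l₁ l₂ : List (Op W M))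
    (s : Config W M) :
    exec L o k (l₁ ++ l₂) s = exec L o (k + l₁.length) l₂ (exec L o k l₁ s) := by
  induction l₁ generalizing k s with
  | nil => rfl
  | cons g l ih => simp [exec, ih, Nat.add_assoc, Nat.add_comm 1]

theorem path_append {b : PauliType} {L : Finset (ℕ × W)} {o : M → ZMod 2} {k : ℕ}
    {l₁ l₂ : List (Op W M)} {s : Config W M} {x x' : W → ZMod 2} :
    Path b L o k (l₁ ++ l₂) s x x' ↔
      ∃ y, Path b L o k l₁ s x y ∧ Path b L o (k + l₁.length) l₂ (exec L o k l₁ s) y x' := by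
  induction l₁ generalizing k s x with
  | nil => simp [Path, exec]
  | cons g l ih =>
    simp only [List.cons_append, Path, ih, exec, List.length_cons, Nat.add_assoc, Nat.add_comm 1]
    constructor
    · rintro ⟨y, h1, z, h2, h3⟩
      exact ⟨z, ⟨y, h1, h2⟩, h3⟩
    · rintro ⟨z, ⟨y, h1, h2⟩, h3⟩
      exact ⟨y, h1, z, h2, h3⟩

/-- Built backwards from the end: a nonzero amplitude after an operation needs a nonzero amplitude
at some predecessor. -/
theorem exists_path [Fintype W] (b : PauliType) (L : Finset (ℕ × W)) (o : M → ZMod 2) (k : ℕ)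
    (l : List (Op W M)) {occ : W → Bool} {s : Config W M} (h : EmptyZero occ s.amp)
    (hl : WellFormed occ l) {x' : W → ZMod 2}
    (hx' : spectrum b (exec L o k l s).amp x' ≠ 0) :
    ∃ x, spectrum b s.amp x ≠ 0 ∧ Path b L o k l s x x' := by
  induction l generalizing k occ s with
  | nil => exact ⟨x', hx', rfl⟩
  | cons g l ih =>
    have h' : EmptyZero occ (lose L k s).amp := h
    obtain ⟨y, hy, hp⟩ := ih (k + 1) (h'.step o g hl.1) hl.2 hx'
    obtain ⟨x, hx, hf⟩ := exists_flow b h' o g hl.1 hy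
    exact ⟨x, hx, y, hf, hp⟩

/-! ### The number of lost atoms does not exceed the number of loss locations -/

section Count

variable [Fintype W] [Fintype M]

/-- No operation creates a loss: preparation clears the flag of its wire, a swap permutes flags on
occupied wires, and a measurement moves a flag from its wire to the readout. -/
theorem lostCount_step_le (occ : W → Bool) (o : M → ZMod 2) (g : Op W M)
    (hg : Admissible occ g) (s : Config W M) :
    lostCount (occupiedAfter occ g) (step o g s) ≤ lostCount occ s := by
  cases g with
  | prep b w =>
    have hl : (step o (.prep b w) s).lost = Function.update s.lost w false := by cases b <;> rfl
    have hr : (step o (.prep b w) s).readout = s.readout := by cases b <;> rfl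
    unfold lostCount
    rw [hl, hr]
    refine Nat.add_le_add_left (Finset.card_le_card fun v hv => ?_) _
    by_cases hvw : v = w
    · subst hvw
      rw [Finset.mem_filter] at hv
      simp at hv
    · rw [Finset.mem_filter] at hv ⊢
      simpa [occupiedAfter, hvw] using hv
  | cnot c t =>
    have : ∀ p : Prop, [Decidable p] → ∀ f, lostCount occ
        (if p then s else { s with amp := f }) = lostCount occ s := by
      intro p _ f; split_ifs <;> rfl
    exact (this _ _).le
  | swap u v =>
    unfold lostCount
    refine Nat.add_le_add_left ?_ _
    refine Finset.card_le_card_of_injOn (Equiv.swap u v) (fun w hw => ?_)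
      (Equiv.injective _).injOn
    rw [Finset.mem_coe, Finset.mem_filter] at hw ⊢
    replace hw := hw.2
    refine ⟨Finset.mem_univ _, ?_⟩
    simp only [occupiedAfter, step] at hw
    refine ⟨?_, hw.2⟩
    by_cases hwu : w = u
    · subst hwu; simpa using hg.2
    by_cases hwv : w = v
    · subst hwv; simpa using hg.1
    rw [Equiv.swap_apply_of_ne_of_ne hwu hwv]
    exact hw.1
  | meas b w κ =>
    have hl : (step o (.meas b w κ) s).lost = s.lost := by cases b <;> rfl
    have hr : (step o (.meas b w κ) s).readout = Function.update s.readout κ (s.lost w) := by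
      cases b <;> rfl
    unfold lostCount
    rw [hl, hr]
    have hw : occ w = true := hg
    have h1 : (Finset.univ.filter fun v =>
        occupiedAfter occ (.meas b w κ : Op W M) v = true ∧ s.lost v = true) =
        (Finset.univ.filter fun v => occ v = true ∧ s.lost v = true).erase w := by
      ext v
      by_cases hv : v = w
      · subst hv
        rw [Finset.mem_filter]
        simp [occupiedAfter]
      · rw [Finset.mem_filter]
        simp [occupiedAfter, hv]
    rw [h1]
    by_cases hlw : s.lost w = true
    · rw [hlw]
      have h2 : (Finset.univ.filter fun μ => Function.update s.readout κ true μ = true) ⊆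
          insert κ (Finset.univ.filter fun μ => s.readout μ = true) := by
        intro μ hμ
        by_cases h : μ = κ
        · simp [h]
        · simpa [h] using hμ
      have h3 := (Finset.card_le_card h2).trans (Finset.card_insert_le _ _)
      have h4 := Finset.card_erase_add_one
        (s := Finset.univ.filter fun v => occ v = true ∧ s.lost v = true) (a := w)
        (by simp [hw, hlw])
      omega
    · rw [Bool.not_eq_true] at hlw
      rw [hlw]
      have h2 : (Finset.univ.filter fun μ => Function.update s.readout κ false μ = true) ⊆
          (Finset.univ.filter fun μ => s.readout μ = true) := by
        intro μ hμ
        by_cases h : μ = κ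
        · subst h; simp at hμ
        · simpa [h] using hμ
      exact Nat.add_le_add (Finset.card_le_card h2) (Finset.card_le_card (Finset.erase_subset _ _))

theorem lostCount_exec_le (L : Finset (ℕ × W)) (o : M → ZMod 2) (k : ℕ) (l : List (Op W M))
    (occ : W → Bool) (hl : WellFormed occ l) (s : Config W M) :
    lostCount (l.foldl occupiedAfter occ) (exec L o k l s) ≤
      lostCount occ s + (L.filter fun p => k ≤ p.1).card := by
  induction l generalizing k occ s with
  | nil => exact Nat.le_add_right _ _
  | cons g l ih =>
    have h1 := ih (k + 1) _ hl.2 (step o g (lose L k s))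
    have h2 := lostCount_step_le occ o g hl.1 (lose L k s)
    have h3 := lostCount_lose_le occ L k s
    have h4 : (L.filter fun p => p.1 = k).card + (L.filter fun p => k + 1 ≤ p.1).card =
        (L.filter fun p => k ≤ p.1).card := by
      rw [← Finset.card_union_of_disjoint]
      · congr 1
        ext p
        simp only [Finset.mem_union, Finset.mem_filter, ← and_or_left]
        refine and_congr_right fun _ => ?_
        omega
      · rw [Finset.disjoint_filter]
        intro p _ h
        omega
    simp only [List.foldl_cons, exec]
    omega

theorem card_readout_exec_le (L : Finset (ℕ × W)) (o : M → ZMod 2) (l : List (Op W M))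
    (occ : W → Bool) (hl : WellFormed occ l) (s : Config W M)
    (hr : ∀ κ, s.readout κ = false) (hs : ∀ w, s.lost w = false) :
    (Finset.univ.filter fun κ => (exec L o 0 l s).readout κ = true).card ≤ L.card := by
  have h := lostCount_exec_le L o 0 l occ hl s
  have h0 : lostCount occ s = 0 := by simp [lostCount, hr, hs]
  rw [h0, Nat.zero_add] at h
  refine (Nat.le_add_right _ _).trans (h.trans (Finset.card_filter_le _ _))

end Count

end Circuits

namespace CSSCode

variable {n nx nz : ℕ}

/-! ### Prefixes of stabilizers -/

/-- The first qubit of a stabilizer. -/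
def first (C : CSSCode n nx nz) (a : Fin nx ⊕ Fin nz) : Fin n := C.qubit a ⟨0, C.weight_pos a⟩

/-- The indicator vector of the first `i` qubits of a stabilizer. -/
def initialSegment (C : CSSCode n nx nz) (a : Fin nx ⊕ Fin nz) (i : ℕ) : Fin n → ZMod 2 :=
  qubitVec (C.qubit a) (Finset.univ.filter fun k => k.val < i)

variable (C : CSSCode n nx nz)

theorem initialSegment_zero (a : Fin nx ⊕ Fin nz) : C.initialSegment a 0 = 0 := by
  simp [initialSegment, qubitVec]

theorem initialSegment_weight (a : Fin nx ⊕ Fin nz) :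
    C.initialSegment a (C.weight a) = C.stab a := by
  simp [initialSegment, stab]

theorem initialSegment_succ (a : Fin nx ⊕ Fin nz) (k : Fin (C.weight a)) :
    C.initialSegment a (k.val + 1) =
      C.initialSegment a k.val + Pi.single (C.qubit a k) 1 := by
  unfold initialSegment qubitVec
  have : (Finset.univ.filter fun k' : Fin (C.weight a) => k'.val < k.val + 1) =
      insert k (Finset.univ.filter fun k' => k'.val < k.val) := by
    ext k'
    simp only [Finset.mem_filter, Finset.mem_univ, true_and, Finset.mem_insert, Fin.ext_iff]
    omega
  rw [this, Finset.sum_insert (by simp), add_comm]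

theorem initialSegment_one (a : Fin nx ⊕ Fin nz) :
    C.initialSegment a 1 = Pi.single (C.first a) 1 := by
  have := C.initialSegment_succ a ⟨0, C.weight_pos a⟩
  rw [initialSegment_zero] at this
  exact this.trans (zero_add _)

/-- This is where segment hooks appear: two losses of the same atom at different times differ by a
contiguous segment. -/
theorem initialSegment_add_of_lt (a : Fin nx ⊕ Fin nz) {i j : ℕ} (hij : i < j)
    (hj : j ≤ C.weight a) :
    C.initialSegment a i + C.initialSegment a j =
      qubitVec (C.qubit a) (Finset.Icc ⟨i, by omega⟩ ⟨j - 1, by omega⟩) := by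
  have h : C.initialSegment a j = C.initialSegment a i +
      qubitVec (C.qubit a) (Finset.Icc ⟨i, by omega⟩ ⟨j - 1, by omega⟩) := by
    unfold initialSegment qubitVec
    rw [← Finset.sum_union]
    · congr 1
      ext k
      simp only [Finset.mem_filter, Finset.mem_univ, true_and, Finset.mem_union, Finset.mem_Icc,
        Fin.le_def]
      omega
    · rw [Finset.disjoint_left]
      intro k hk hk'
      simp only [Finset.mem_filter, Finset.mem_univ, true_and, Finset.mem_Icc,
        Fin.le_def] at hk hk'
      omega
  rw [h, ← add_assoc, ZModModule.add_self, zero_add]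

/-- Length bound for the initial segments on which the loss of one atom of ancilla `a` acts in
the basis `b`. -/
def reach (b : PauliType) (a : Fin nx ⊕ Fin nz) : ℕ := if kind a = b then 1 else C.weight a

/-- The span of the stabilizers of the type other than `b`. -/
def gauge (b : PauliType) : Submodule (ZMod 2) (Fin n → ZMod 2) :=
  Submodule.span (ZMod 2) {v | ∃ a, kind a ≠ b ∧ v = C.stab a}

/-! ### The invariant of a phase -/

/-- The effect `v` on the data qubits of ancilla `a` after its first `j` interactions, where `l`
tells whether the atom on its wire is lost, and `r` is the bit value of that atom. -/
def Effect (b : PauliType) (a : Fin nx ⊕ Fin nz) (j : ℕ) (l : Bool) (r : ZMod 2)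
    (v : Fin n → ZMod 2) : Prop :=
  (j = 0 → v = 0 ∧ (kind a = b → r = 0)) ∧
  (0 < j → (l = false → v = if kind a = b then 0 else r • C.initialSegment a j) ∧
    (l = true → ∃ i, i ≤ j ∧ i ≤ C.reach b a ∧ v = C.initialSegment a i))

variable {C}

/-- A present atom may become lost at any time: since `r` is a bit, its effect so far is already the
initial segment of length `0` or `j`. At `j = 0` the flag is irrelevant, because a fresh atom lost
then is shuttled onto the data wire. -/
theorem Effect.mono {b : PauliType} {a : Fin nx ⊕ Fin nz} {j : ℕ} {l l' : Bool} {r : ZMod 2}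
    {v : Fin n → ZMod 2} (h : C.Effect b a j l r v) (hj : j ≤ C.weight a)
    (hl : l = true → l' = true) : C.Effect b a j l' r v := by
  refine ⟨h.1, fun hpos => ?_⟩
  cases l with
  | true => rw [hl rfl]; exact h.2 hpos
  | false =>
    have hv := (h.2 hpos).1 rfl
    refine ⟨fun _ => hv, fun _ => ?_⟩
    by_cases hk : kind a = b
    · exact ⟨0, Nat.zero_le _, Nat.zero_le _, by rw [hv, if_pos hk, initialSegment_zero]⟩
    · rw [if_neg hk] at hv
      rcases zmod_two_cases r with rfl | rfl
      · exact ⟨0, Nat.zero_le _, Nat.zero_le _, by rw [hv, zero_smul, initialSegment_zero]⟩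
      · exact ⟨j, le_rfl, by rw [reach, if_neg hk]; exact hj, by rw [hv, one_smul]⟩

/-- The bit values `x` agree on the data atoms present with a reference word `base`, modified by
the ancillas according to their progress `pr`. -/
def PhaseInv (C : CSSCode n nx nz) (b : PauliType) (base : Fin n → ZMod 2)
    (pr : Fin nx ⊕ Fin nz → ℕ) (lost : Wire n nx nz → Bool) (x : Wire n nx nz → ZMod 2) : Prop :=
  ∃ P : Fin nx ⊕ Fin nz → Fin n → ZMod 2,
    (∀ q, lost (Sum.inl q) = false → x (Sum.inl q) = (base + ∑ a, P a) q) ∧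
    ∀ a, pr a ≤ C.weight a ∧ C.Effect b a (pr a) (lost (Sum.inr a)) (x (Sum.inr a)) (P a)

theorem PhaseInv.advance {b : PauliType} {base : Fin n → ZMod 2} {pr : Fin nx ⊕ Fin nz → ℕ}
    {lost lost' : Wire n nx nz → Bool} {x x' : Wire n nx nz → ZMod 2}
    {a : Fin nx ⊕ Fin nz} {k : Fin (C.weight a)} {P : Fin nx ⊕ Fin nz → Fin n → ZMod 2}
    (hx : ∀ q, lost (Sum.inl q) = false → x (Sum.inl q) = (base + ∑ a, P a) q)
    (hP : ∀ a, pr a ≤ C.weight a ∧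
      C.Effect b a (pr a) (lost (Sum.inr a)) (x (Sum.inr a)) (P a))
    (hk : k.val = pr a) (c : ZMod 2)
    (hanc : ∀ a', a' ≠ a → (lost (Sum.inr a') = true → lost' (Sum.inr a') = true) ∧
      x' (Sum.inr a') = x (Sum.inr a'))
    (hdat : ∀ q, q ≠ C.qubit a k → (lost (Sum.inl q) = true → lost' (Sum.inl q) = true) ∧
      x' (Sum.inl q) = x (Sum.inl q))
    (hq : lost' (Sum.inl (C.qubit a k)) = false →
      x' (Sum.inl (C.qubit a k)) = (base + ∑ a, P a) (C.qubit a k) + c)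
    (ha : C.Effect b a (k.val + 1) (lost' (Sum.inr a)) (x' (Sum.inr a))
      (P a + c • Pi.single (C.qubit a k) 1)) :
    C.PhaseInv b base (Function.update pr a (pr a + 1)) lost' x' := by
  refine ⟨Function.update P a (P a + c • Pi.single (C.qubit a k) 1), fun q hlq => ?_,
    fun a' => ?_⟩
  · have hsum : ∑ a', Function.update P a (P a + c • Pi.single (C.qubit a k) 1) a' =
        ∑ a', P a' + c • Pi.single (C.qubit a k) 1 := by
      rw [Finset.sum_update_of_mem (Finset.mem_univ a),
        ← Finset.add_sum_erase _ P (Finset.mem_univ a), Finset.sdiff_singleton_eq_erase]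
      abel
    rw [hsum, ← add_assoc, Pi.add_apply (base + _)]
    by_cases hqk : q = C.qubit a k
    · subst hqk
      simpa using hq hlq
    · have hl : lost (Sum.inl q) = false := by
        by_contra hne
        rw [(hdat q hqk).1 (by simpa using hne)] at hlq
        exact Bool.noConfusion hlq
      rw [(hdat q hqk).2, hx q hl]
      simp [hqk]
  · by_cases haa : a' = a
    · subst haa
      simp only [Function.update_self]
      rw [← hk]
      exact ⟨k.isLt, ha⟩
    · simp only [Function.update_of_ne haa]
      rw [(hanc a' haa).2]
      exact ⟨(hP a').1, (hP a').2.mono (hP a').1 (hanc a' haa).1⟩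

/-! ### Single interactions of an ancilla with a data qubit. -/

variable {T : ℕ}

/-- The `CNOT` between an ancilla and one of its qubits. -/
def coupling (p : Σ a : Fin nx ⊕ Fin nz, Fin (C.weight a)) :
    Op (Wire n nx nz) (Label n nx nz T) :=
  match kind p.1 with
    | .X => Op.cnot (Sum.inr p.1) (Sum.inl (C.qubit p.1 p.2))
    | .Z => Op.cnot (Sum.inl (C.qubit p.1 p.2)) (Sum.inr p.1)

theorem gate_eq (p : Σ a : Fin nx ⊕ Fin nz, Fin (C.weight a)) :
    gate (T := T) p = coupling p ::
      (if p.2.val = 0 then [Op.swap (Sum.inr p.1) (Sum.inl (C.qubit p.1 p.2))] else []) := rfl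

theorem coupling_step (p : Σ a : Fin nx ⊕ Fin nz, Fin (C.weight a)) (o : Label n nx nz T → ZMod 2)
    (s : Config (Wire n nx nz) (Label n nx nz T)) :
    (step o (coupling p) s).lost = s.lost ∧ (step o (coupling p) s).readout = s.readout := by
  unfold coupling step
  cases kind p.1 <;> constructor <;> simp only <;> split_ifs <;> rfl

theorem coupling_flow {b : PauliType} {o : Label n nx nz T → ZMod 2} {a : Fin nx ⊕ Fin nz}
    {k : Fin (C.weight a)} {lost : Wire n nx nz → Bool} {x x' : Wire n nx nz → ZMod 2}
    (h : Flow b o lost (coupling ⟨a, k⟩) x x') :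
    (∀ w, w ≠ Sum.inr a → w ≠ Sum.inl (C.qubit a k) → x' w = x w) ∧
    (lost (Sum.inr a) = true ∨ lost (Sum.inl (C.qubit a k)) = true → x' = x) ∧
    (kind a = b → x' (Sum.inl (C.qubit a k)) = x (Sum.inl (C.qubit a k)) ∧
      (lost (Sum.inr a) = false → lost (Sum.inl (C.qubit a k)) = false →
        x' (Sum.inr a) = x (Sum.inr a) + x (Sum.inl (C.qubit a k)))) ∧
    (kind a ≠ b → x' (Sum.inr a) = x (Sum.inr a) ∧
      (lost (Sum.inr a) = false → lost (Sum.inl (C.qubit a k)) = false →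
        x' (Sum.inl (C.qubit a k)) = x (Sum.inl (C.qubit a k)) + x (Sum.inr a))) := by
  unfold coupling at h
  generalize C.qubit a k = q at *
  simp only at h
  generalize kind a = c at *
  cases b <;> cases c <;> simp only [Flow] at h <;> subst h <;>
    cases h1 : lost (Sum.inr a) <;> cases h2 : lost (Sum.inl q) <;>
    simp +contextual [add_comm]

theorem PhaseInv.later_gate {b : PauliType} {base : Fin n → ZMod 2} {pr : Fin nx ⊕ Fin nz → ℕ}
    {L : Finset (ℕ × Wire n nx nz)} {o : Label n nx nz T → ZMod 2} {t : ℕ}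
    {s : Config (Wire n nx nz) (Label n nx nz T)} {x x' : Wire n nx nz → ZMod 2}
    {a : Fin nx ⊕ Fin nz} {k : Fin (C.weight a)} (h : C.PhaseInv b base pr s.lost x)
    (hk : k.val = pr a) (hpos : 0 < k.val)
    (hp : Path b L o t [coupling ⟨a, k⟩] s x x') :
    C.PhaseInv b base (Function.update pr a (pr a + 1))
      (exec L o t [coupling ⟨a, k⟩] s).lost x' := by
  obtain ⟨P, hx, hP⟩ := h
  obtain ⟨y, hf, rfl⟩ := hp
  have hlost : (exec L o t [coupling ⟨a, k⟩] s).lost = (lose L t s).lost :=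
    (coupling_step _ _ _).1
  have hmono : ∀ w, s.lost w = true → (lose L t s).lost w = true := fun w hw => by
    simp [lose, hw]
  rw [hlost]
  generalize (lose L t s).lost = l at *
  have hmono_inv : ∀ w, l w = false → s.lost w = false := fun w hw => by
    by_contra hne
    rw [hmono w (by simpa using hne)] at hw
    exact Bool.noConfusion hw
  obtain ⟨h1, h2, h3, h4⟩ := coupling_flow hf
  have hE := (hP a).2.mono (hP a).1 (hmono (Sum.inr a))
  rw [← hk] at hE
  have hanc : ∀ a', a' ≠ a → (s.lost (Sum.inr a') = true → l (Sum.inr a') = true) ∧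
      x' (Sum.inr a') = x (Sum.inr a') := fun a' ha' =>
    ⟨hmono _, h1 _ (by simpa using ha') (by simp)⟩
  have hdat : ∀ q, q ≠ C.qubit a k → (s.lost (Sum.inl q) = true → l (Sum.inl q) = true) ∧
      x' (Sum.inl q) = x (Sum.inl q) := fun q hq =>
    ⟨hmono _, h1 _ (by simp) (by simpa using hq)⟩
  by_cases hkind : kind a = b
  · refine PhaseInv.advance hx hP hk 0 hanc hdat (fun hl => ?_) ⟨fun h0 => by omega, fun _ => ?_⟩
    · rw [(h3 hkind).1, hx _ (hmono_inv _ hl), add_zero]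
    · rw [zero_smul, add_zero]
      refine ⟨fun hl => ?_, fun hl => ?_⟩
      · rw [(hE.2 hpos).1 hl, if_pos hkind, if_pos hkind]
      · obtain ⟨i, hi, hi', hv⟩ := (hE.2 hpos).2 hl
        exact ⟨i, by omega, hi', hv⟩
  -- A present ancilla extends its segment even if the data atom is lost and the gate is removed:
  -- the invariant says nothing about lost data atoms.
  · refine PhaseInv.advance hx hP hk (if l (Sum.inr a) = true then 0 else x (Sum.inr a)) hanc hdat
      (fun hl => ?_) ⟨fun h0 => by omega, fun _ => ⟨fun hl => ?_, fun hl => ?_⟩⟩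
    · split_ifs with hla
      · rw [h2 (Or.inl hla), hx _ (hmono_inv _ hl), add_zero]
      · rw [(h4 hkind).2 (by simpa using hla) hl, hx _ (hmono_inv _ hl)]
    · rw [if_neg (by simp [hl]), (hE.2 hpos).1 hl, if_neg hkind, if_neg hkind, (h4 hkind).1,
        initialSegment_succ, smul_add]
    · obtain ⟨i, hi, hi', hv⟩ := (hE.2 hpos).2 hl
      rw [if_pos hl, zero_smul, add_zero]
      exact ⟨i, by omega, hi', hv⟩

theorem one_le_reach (b : PauliType) (a : Fin nx ⊕ Fin nz) : 1 ≤ C.reach b a := by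
  unfold reach
  split_ifs
  · exact le_rfl
  · exact C.weight_pos a

/-- The SWAP hands the old data atom, with any loss it has suffered, to the ancilla wire. From here
on damage at the first qubit is charged to that ancilla, and a loss of the fresh atom becomes a data
loss, charged when that atom is measured. -/
theorem PhaseInv.first_gate {b : PauliType} {base : Fin n → ZMod 2} {pr : Fin nx ⊕ Fin nz → ℕ}
    {L : Finset (ℕ × Wire n nx nz)} {o : Label n nx nz T → ZMod 2} {t : ℕ}
    {s : Config (Wire n nx nz) (Label n nx nz T)} {x x' : Wire n nx nz → ZMod 2}
    {a : Fin nx ⊕ Fin nz} {k : Fin (C.weight a)} (h : C.PhaseInv b base pr s.lost x)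
    (hk : k.val = pr a) (h0 : k.val = 0)
    (hp : Path b L o t [coupling ⟨a, k⟩, .swap (Sum.inr a) (Sum.inl (C.qubit a k))] s x x') :
    C.PhaseInv b base (Function.update pr a (pr a + 1))
      (exec L o t [coupling ⟨a, k⟩, .swap (Sum.inr a) (Sum.inl (C.qubit a k))] s).lost x' := by
  obtain ⟨P, hx, hP⟩ := h
  obtain ⟨y, hf, z, hz, rfl⟩ := hp
  set s₁ := lose L t s with hs₁
  set s₂ := lose L (t + 1) (step o (coupling ⟨a, k⟩) s₁) with hs₂
  have hlost : (exec L o t [coupling ⟨a, k⟩, .swap (Sum.inr a) (Sum.inl (C.qubit a k))] s).lost =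
      fun w => s₂.lost (Equiv.swap (Sum.inr a) (Sum.inl (C.qubit a k)) w) := rfl
  have hz' : x' = fun w => y (Equiv.swap (Sum.inr a) (Sum.inl (C.qubit a k)) w) := hz
  have hm₁ : ∀ w, s₁.lost w = false → s.lost w = false := fun w hw => by
    simp only [hs₁, lose, Bool.or_eq_false_iff] at hw
    exact hw.1
  have hm₂ : ∀ w, s₂.lost w = false → s₁.lost w = false := fun w hw => by
    simp only [hs₂, lose, Bool.or_eq_false_iff] at hw
    rw [← (coupling_step ⟨a, k⟩ o s₁).1]
    exact hw.1
  have hmono : ∀ w, s.lost w = true → s₂.lost w = true := fun w hw => by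
    by_contra hne
    rw [hm₁ w (hm₂ w (by simpa using hne))] at hw
    exact Bool.noConfusion hw
  rw [hlost, hz']
  obtain ⟨h1, h2, h3, h4⟩ := coupling_flow hf
  clear_value s₁ s₂
  have hPa := (hP a).2
  rw [← hk] at hPa
  obtain ⟨hPa, hr⟩ := hPa.1 h0
  have hseg : C.initialSegment a (k.val + 1) = Pi.single (C.qubit a k) 1 := by
    rw [initialSegment_succ, h0, initialSegment_zero, zero_add]
  set W := (base + ∑ a, P a) (C.qubit a k) with hW
  refine PhaseInv.advance hx hP hk
    -- If the old data atom is lost, the flip replaces the reference bit `W` by the bit of the fresh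
    -- atom. Otherwise a type-`b` ancilla receives a copy of the data bit, so nothing changes; for
    -- the other type, the fresh atom's bit differs from `W` by the bit that moves to the ancilla
    -- wire.
    (if s₂.lost (Sum.inl (C.qubit a k)) = true then W + y (Sum.inr a)
      else if kind a = b then 0 else y (Sum.inl (C.qubit a k)))
    (fun a' ha' => ?_) (fun q hq => ?_) ?_ ⟨fun h => by omega, fun _ => ⟨?_, ?_⟩⟩
  · rw [Equiv.swap_apply_of_ne_of_ne (by simpa using ha') (by simp)]
    exact ⟨hmono _, h1 _ (by simpa using ha') (by simp)⟩
  · rw [Equiv.swap_apply_of_ne_of_ne (by simp) (by simpa using hq)]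
    exact ⟨hmono _, h1 _ (by simp) (by simpa using hq)⟩
  · simp only [Equiv.swap_apply_right]
    intro hla
    rw [← hW]
    split_ifs with hlq hkind
    · rw [← add_assoc, CharTwo.add_self_eq_zero, zero_add]
    · have hlq' := hm₂ _ (by simpa using hlq)
      rw [(h3 hkind).2 (hm₂ _ hla) hlq', hr hkind, zero_add, add_zero, hx _ (hm₁ _ hlq')]
    · have hlq' := hm₂ _ (by simpa using hlq)
      rw [(h4 hkind).2 (hm₂ _ hla) hlq', (h4 hkind).1, hx _ (hm₁ _ hlq'), ← hW, ← add_assoc,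
        CharTwo.add_self_eq_zero, zero_add]
  · simp only [Equiv.swap_apply_left]
    intro hlq
    rw [if_neg (by simp [hlq]), hPa, zero_add, hseg]
    split_ifs <;> simp
  · simp only [Equiv.swap_apply_left]
    intro hlq
    rw [if_pos hlq, hPa, zero_add]
    rcases zmod_two_cases (W + y (Sum.inr a)) with hc | hc
    · exact ⟨0, by omega, Nat.zero_le _, by rw [hc, zero_smul, initialSegment_zero]⟩
    · exact ⟨k.val + 1, le_rfl, by rw [h0]; exact one_le_reach b a, by rw [hc, one_smul, hseg]⟩

theorem PhaseInv.gate {b : PauliType} {base : Fin n → ZMod 2} {pr : Fin nx ⊕ Fin nz → ℕ}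
    {L : Finset (ℕ × Wire n nx nz)} {o : Label n nx nz T → ZMod 2} {t : ℕ}
    {s : Config (Wire n nx nz) (Label n nx nz T)} {x x' : Wire n nx nz → ZMod 2}
    {p : Σ a : Fin nx ⊕ Fin nz, Fin (C.weight a)} (h : C.PhaseInv b base pr s.lost x)
    (hk : p.2.val = pr p.1) (hp : Path b L o t (CSSCode.gate p) s x x') :
    C.PhaseInv b base (Function.update pr p.1 (pr p.1 + 1))
      (exec L o t (CSSCode.gate p) s).lost x' ∧
      (exec L o t (CSSCode.gate p) s).readout = s.readout := by
  obtain ⟨a, k⟩ := p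
  rw [gate_eq] at hp ⊢
  by_cases h0 : k.val = 0
  · rw [if_pos h0] at hp ⊢
    exact ⟨h.first_gate hk h0 hp, (coupling_step _ _ _).2⟩
  · rw [if_neg h0] at hp ⊢
    exact ⟨h.later_gate hk (Nat.pos_of_ne_zero h0) hp, (coupling_step _ _ _).2⟩

/-- A list of interactions that brings all ancillas from the progress `pr` to the end, each in
the order of its qubits. -/
def Completes (C : CSSCode n nx nz) :
    (Fin nx ⊕ Fin nz → ℕ) → List (Σ a : Fin nx ⊕ Fin nz, Fin (C.weight a)) → Prop
  | pr, [] => ∀ a, pr a = C.weight a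
  | pr, p :: l => p.2.val = pr p.1 ∧ C.Completes (Function.update pr p.1 (pr p.1 + 1)) l

/-- The head is the lowest outstanding interaction of its ancilla: a lower one would come later in
the list, against the order. -/
theorem completes_of_pairwise (l : List (Σ a : Fin nx ⊕ Fin nz, Fin (C.weight a)))
    (hl : l.Pairwise fun p r => p.1 = r.1 → p.2.val < r.2.val) (pr : Fin nx ⊕ Fin nz → ℕ)
    (hw : ∀ a, pr a ≤ C.weight a) (hmem : ∀ p, p ∈ l ↔ pr p.1 ≤ p.2.val) : C.Completes pr l := by
  induction l generalizing pr with
  | nil =>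
    intro a
    by_contra hne
    have hlt : pr a < C.weight a := lt_of_le_of_ne (hw a) hne
    simpa using (hmem ⟨a, ⟨pr a, hlt⟩⟩).2 le_rfl
  | cons p l ih =>
    rw [List.pairwise_cons] at hl
    obtain ⟨a, k⟩ := p
    have hle : pr a ≤ k.val := (hmem ⟨a, k⟩).1 (by simp)
    have hk : k.val = pr a := by
      by_contra hne
      have hlt : pr a < k.val := lt_of_le_of_ne hle (Ne.symm hne)
      have hm := (hmem ⟨a, ⟨pr a, hlt.trans k.isLt⟩⟩).2 le_rfl
      rcases List.mem_cons.mp hm with h | h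
      · have := eq_of_heq (Sigma.mk.inj h).2
        rw [← this] at hlt
        exact lt_irrefl _ hlt
      · have := hl.1 _ h rfl
        simp only at this
        omega
    refine ⟨hk, ih hl.2 _ (fun a' => ?_) fun r => ?_⟩
    · by_cases h : a' = a
      · subst h
        simp only [Function.update_self]
        omega
      · simpa [h] using hw a'
    · obtain ⟨a', k'⟩ := r
      have hm := hmem ⟨a', k'⟩
      simp only [List.mem_cons] at hm
      by_cases h : a' = a
      · subst h
        simp only [Function.update_self]
        constructor
        · intro hr
          have := hl.1 _ hr rfl
          simp only at this
          omega
        · intro hr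
          refine (hm.2 (by omega)).resolve_left fun he => ?_
          have := eq_of_heq (Sigma.mk.inj he).2
          subst this
          omega
      · simp only [Function.update_of_ne h]
        rw [← hm]
        exact ⟨Or.inr, fun hr => hr.resolve_left fun he => h (Sigma.mk.inj he).1⟩

/-- The two phases involve disjoint sets of ancillas, so they can be treated as one list; only the
order within each ancilla matters. -/
theorem Schedule.completes (σ : C.Schedule) : C.Completes 0 (σ.order .X ++ σ.order .Z) := by
  refine completes_of_pairwise _ ?_ _ (fun a => Nat.zero_le _) fun p => ?_
  · rw [List.pairwise_append]
    refine ⟨σ.ordered _, σ.ordered _, fun p hp r hr h => ?_⟩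
    rw [σ.mem_order] at hp hr
    rw [h, hr] at hp
    exact PauliType.noConfusion hp
  · rw [List.mem_append, σ.mem_order, σ.mem_order]
    cases kind p.1 <;> simp

theorem PhaseInv.gates {b : PauliType} {base : Fin n → ZMod 2}
    {L : Finset (ℕ × Wire n nx nz)} {o : Label n nx nz T → ZMod 2}
    (l : List (Σ a : Fin nx ⊕ Fin nz, Fin (C.weight a))) {t : ℕ} {pr : Fin nx ⊕ Fin nz → ℕ}
    {s : Config (Wire n nx nz) (Label n nx nz T)} {x x' : Wire n nx nz → ZMod 2}
    (h : C.PhaseInv b base pr s.lost x) (hl : C.Completes pr l)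
    (hp : Path b L o t (l.flatMap CSSCode.gate) s x x') :
    C.PhaseInv b base C.weight (exec L o t (l.flatMap CSSCode.gate) s).lost x' ∧
      (exec L o t (l.flatMap CSSCode.gate) s).readout = s.readout := by
  induction l generalizing t pr s x with
  | nil =>
    have hpr : pr = C.weight := funext hl
    obtain rfl : x' = x := hp
    exact ⟨hpr ▸ h, rfl⟩
  | cons p l ih =>
    rw [List.flatMap_cons] at hp ⊢
    rw [path_append] at hp
    rw [exec_append]
    obtain ⟨y, h1, h2⟩ := hp
    obtain ⟨h3, h4⟩ := h.gate hl.1 h1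
    obtain ⟨h5, h6⟩ := ih h3 hl.2 h2
    exact ⟨h5, h6.trans h4⟩

/-! ### Preparation and measurement -/

theorem prep_phase {b : PauliType} {L : Finset (ℕ × Wire n nx nz)}
    {o : Label n nx nz T → ZMod 2} (l : List (Fin nx ⊕ Fin nz)) {t : ℕ}
    {s : Config (Wire n nx nz) (Label n nx nz T)} {x x' : Wire n nx nz → ZMod 2}
    (hp : Path b L o t (l.map fun a => Op.prep (kind a) (Sum.inr a)) s x x') :
    (∀ q, x' (Sum.inl q) = x (Sum.inl q)) ∧
    (∀ a, kind a = b → (a ∈ l ∨ x (Sum.inr a) = 0) → x' (Sum.inr a) = 0) ∧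
    (∀ q, s.lost (Sum.inl q) = true →
      (exec L o t (l.map fun a => Op.prep (kind a) (Sum.inr a)) s).lost (Sum.inl q) = true) ∧
    (exec L o t (l.map fun a => Op.prep (kind a) (Sum.inr a)) s).readout = s.readout := by
  induction l generalizing t s x with
  | nil =>
    obtain rfl : x' = x := hp
    exact ⟨fun _ => rfl, fun a _ h => by simpa using h, fun _ h => h, rfl⟩
  | cons a l ih =>
    obtain ⟨y, hf, hp⟩ := hp
    obtain ⟨h1, h2, h3, h4⟩ := ih hp
    have hl : (step o (.prep (kind a) (Sum.inr a)) (lose L t s)).lost =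
        Function.update (lose L t s).lost (Sum.inr a) false := by cases kind a <;> rfl
    have hr : (step o (.prep (kind a) (Sum.inr a)) (lose L t s)).readout = s.readout := by
      cases kind a <;> rfl
    refine ⟨fun q => (h1 q).trans (hf.1 _ (by simp)), fun a' hb ha' => h2 a' hb ?_,
      fun q hq => h3 q ?_, h4.trans hr⟩
    · by_cases haa : a' = a
      · subst haa
        exact Or.inr (hf.2 hb)
      · rw [hf.1 _ (by simpa using haa)]
        exact ha'.imp_left fun h => (List.mem_cons.mp h).resolve_left haa
    · rw [hl, Function.update_of_ne (by simp)]
      simp [lose, hq]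

theorem meas_phase {ι W M : Type} [DecidableEq W] [DecidableEq M] {b : PauliType}
    {L : Finset (ℕ × W)} {o : M → ZMod 2} (kd : ι → PauliType) (wire : ι → W) (lab : ι → M)
    (hwire : Function.Injective wire) (hlab : Function.Injective lab)
    (l : List ι) (hl : l.Nodup) {t : ℕ} {s : Config W M} {x x' : W → ZMod 2}
    (hp : Path b L o t (l.map fun i => Op.meas (kd i) (wire i) (lab i)) s x x') :
    (∀ w, (∀ i ∈ l, w ≠ wire i) → x' w = x w) ∧
    (∀ i ∈ l, kd i = b → x (wire i) = o (lab i)) ∧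
    (∀ w, s.lost w = true →
      (exec L o t (l.map fun i => Op.meas (kd i) (wire i) (lab i)) s).lost w = true) ∧
    (∀ κ, (∀ i ∈ l, κ ≠ lab i) →
      (exec L o t (l.map fun i => Op.meas (kd i) (wire i) (lab i)) s).readout κ = s.readout κ) ∧
    (∀ i ∈ l, s.lost (wire i) = true →
      (exec L o t (l.map fun i => Op.meas (kd i) (wire i) (lab i)) s).readout (lab i) = true) := by
  induction l generalizing t s x with
  | nil =>
    obtain rfl : x' = x := hp
    exact ⟨fun _ _ => rfl, by simp, fun _ h => h, fun _ _ => rfl, by simp⟩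
  | cons i l ih =>
    obtain ⟨y, hf, hp⟩ := hp
    rw [List.nodup_cons] at hl
    obtain ⟨h1, h2, h3, h4, h5⟩ := ih hl.2 hp
    have hlost : (step o (.meas (kd i) (wire i) (lab i)) (lose L t s)).lost =
        (lose L t s).lost := by cases kd i <;> rfl
    have hread : (step o (.meas (kd i) (wire i) (lab i)) (lose L t s)).readout =
        Function.update s.readout (lab i) ((lose L t s).lost (wire i)) := by
      cases kd i <;> rfl
    have hmono : ∀ w, s.lost w = true → (lose L t s).lost w = true := fun w hw => by
      simp [lose, hw]
    rw [hlost] at h3 h5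
    rw [hread] at h4
    have hne : ∀ j ∈ l, j ≠ i := fun j hj h => hl.1 (h ▸ hj)
    refine ⟨fun w hw => ?_, fun j hj hb => ?_, fun w hw => h3 w (hmono w hw), fun κ hκ => ?_,
      fun j hj hjl => ?_⟩
    · rw [h1 w fun j hj => hw j (List.mem_cons_of_mem _ hj), hf.1 w (hw i (by simp))]
    · rcases List.mem_cons.mp hj with rfl | hj
      · exact hf.2 hb
      · rw [← h2 j hj hb, hf.1 _ (hwire.ne (hne j hj))]
    · rw [List.map_cons, exec, h4 κ fun j hj => hκ j (List.mem_cons_of_mem _ hj),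
        Function.update_of_ne (hκ i (by simp))]
    · rcases List.mem_cons.mp hj with rfl | hj
      · rw [List.map_cons, exec, h4 _ fun i hi => hlab.ne (hne i hi).symm, Function.update_self,
          hmono _ hjl]
      · exact h5 j hj (hmono _ hjl)

theorem mem_ancillas (a : Fin nx ⊕ Fin nz) : a ∈ ancillas nx nz := by
  cases a <;> simp [ancillas]

theorem nodup_ancillas : (ancillas nx nz).Nodup := by
  unfold ancillas
  rw [List.nodup_append]
  refine ⟨(List.nodup_finRange _).map Sum.inl_injective,
    (List.nodup_finRange _).map Sum.inr_injective, ?_⟩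
  intro a ha b hb
  simp only [List.mem_map] at ha hb
  obtain ⟨i, -, rfl⟩ := ha
  obtain ⟨j, -, rfl⟩ := hb
  exact Sum.inl_ne_inr

/-! ### The memory experiment is well-formed -/

/-- The occupied wires between two cycles: the data wires. -/
def dataOnly : Wire n nx nz → Bool
  | .inl _ => true
  | .inr _ => false

theorem wellFormed_preps (l : List (Fin nx ⊕ Fin nz)) (hl : l.Nodup) (occ : Wire n nx nz → Bool)
    (hocc : ∀ a ∈ l, occ (Sum.inr a) = false) :
    WellFormed occ
      (l.map fun a => (Op.prep (kind a) (Sum.inr a) : Op _ (Label n nx nz T))) ∧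
    (l.map fun a => (Op.prep (kind a) (Sum.inr a) : Op _ (Label n nx nz T))).foldl
      occupiedAfter occ = fun w => occ w || decide (∃ a ∈ l, w = Sum.inr a) := by
  induction l generalizing occ with
  | nil => simp [WellFormed]
  | cons a l ih =>
    rw [List.nodup_cons] at hl
    obtain ⟨h1, h2⟩ := ih hl.2 (Function.update occ (Sum.inr a) true) fun a' ha' => by
      have hne : a' ≠ a := fun h => hl.1 (h ▸ ha')
      simpa [hne] using hocc a' (List.mem_cons_of_mem _ ha')
    refine ⟨⟨hocc a (by simp), h1⟩, ?_⟩
    rw [List.map_cons, List.foldl_cons, occupiedAfter, h2]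
    funext w
    rw [Bool.eq_iff_iff]
    by_cases hw : w = Sum.inr a
    · subst hw; simp
    · simp only [Function.update_of_ne hw, Bool.or_eq_true, decide_eq_true_eq, List.mem_cons,
        exists_eq_or_imp, hw, false_or]

theorem wellFormed_meas {ι W M : Type} [DecidableEq W] (kd : ι → PauliType)
    (wire : ι → W) (lab : ι → M) (hwire : Function.Injective wire) (l : List ι) (hl : l.Nodup)
    (occ : W → Bool) (hocc : ∀ i ∈ l, occ (wire i) = true) :
    WellFormed occ (l.map fun i => Op.meas (kd i) (wire i) (lab i)) ∧
    (l.map fun i => Op.meas (kd i) (wire i) (lab i)).foldl occupiedAfter occ =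
      fun w => occ w && decide (∀ i ∈ l, w ≠ wire i) := by
  classical
  induction l generalizing occ with
  | nil => simp [WellFormed]
  | cons i l ih =>
    rw [List.nodup_cons] at hl
    obtain ⟨h1, h2⟩ := ih hl.2 (Function.update occ (wire i) false) fun j hj => by
      have hne : j ≠ i := fun h => hl.1 (h ▸ hj)
      simpa [hwire.ne hne] using hocc j (List.mem_cons_of_mem _ hj)
    refine ⟨⟨hocc i (by simp), h1⟩, ?_⟩
    rw [List.map_cons, List.foldl_cons, occupiedAfter, h2]
    funext w
    by_cases hw : w = wire i
    · subst hw; simp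
    · simp [hw]

theorem wellFormed_gates (l : List (Σ a : Fin nx ⊕ Fin nz, Fin (C.weight a))) :
    WellFormed (fun _ => true) (l.flatMap (gate (T := T))) ∧
    (l.flatMap (gate (T := T))).foldl occupiedAfter (fun _ => true) = fun _ => true := by
  have hgate : ∀ p, WellFormed (fun _ => true) (gate (C := C) (T := T) p) ∧
      (gate (C := C) (T := T) p).foldl occupiedAfter (fun _ => true) = fun _ => true := by
    intro p
    rw [gate_eq]
    unfold coupling
    cases kind p.1 <;> simp only <;> split_ifs <;>
      simp [WellFormed, Admissible, occupiedAfter]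
  induction l with
  | nil => simp [WellFormed]
  | cons p l ih =>
    rw [List.flatMap_cons, wellFormed_append, List.foldl_append, (hgate p).2]
    exact ⟨⟨(hgate p).1, ih.1⟩, ih.2⟩

theorem cycle_eq (σ : C.Schedule) (c : Fin T) :
    cycle σ c = (ancillas nx nz).map (fun a => Op.prep (kind a) (Sum.inr a)) ++
      ((σ.order .X ++ σ.order .Z).flatMap gate ++
        (ancillas nx nz).map (fun a => Op.meas (kind a) (Sum.inr a) (Sum.inl (c, a)))) := by
  simp only [cycle, List.flatMap_append, List.append_assoc]

theorem wellFormed_cycle (σ : C.Schedule) (c : Fin T) :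
    WellFormed dataOnly (cycle σ c) ∧ (cycle σ c).foldl occupiedAfter dataOnly = dataOnly := by
  rw [cycle_eq, wellFormed_append, List.foldl_append, wellFormed_append, List.foldl_append]
  obtain ⟨h1, h2⟩ := wellFormed_preps (T := T) (ancillas nx nz) nodup_ancillas
    (dataOnly (n := n)) (fun _ _ => rfl)
  have h3 : (fun w : Wire n nx nz => dataOnly w || decide (∃ a ∈ ancillas nx nz, w = Sum.inr a)) =
      fun _ => true := by
    funext w
    cases w <;> simp [dataOnly, mem_ancillas]
  obtain ⟨h4, h5⟩ := wellFormed_gates (T := T) (σ.order .X ++ σ.order .Z)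
  obtain ⟨h6, h7⟩ := wellFormed_meas kind (Sum.inr : _ → Wire n nx nz)
    (fun a => (Sum.inl (c, a) : Label n nx nz T)) Sum.inr_injective (ancillas nx nz)
    nodup_ancillas (fun _ => true) (fun _ _ => rfl)
  rw [h2, h3, h5, h7]
  refine ⟨⟨h1, h4, h6⟩, ?_⟩
  funext w
  cases w <;> simp [dataOnly, mem_ancillas]

theorem wellFormed_memory (σ : C.Schedule) (b : PauliType) :
    WellFormed dataOnly (memory σ b T) := by
  have hcycles : ∀ cs : List (Fin T), WellFormed dataOnly (cs.flatMap (cycle σ)) ∧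
      (cs.flatMap (cycle σ)).foldl occupiedAfter dataOnly = dataOnly := by
    intro cs
    induction cs with
    | nil => simp [WellFormed]
    | cons c cs ih =>
      rw [List.flatMap_cons, wellFormed_append, List.foldl_append, (wellFormed_cycle σ c).2]
      exact ⟨⟨(wellFormed_cycle σ c).1, ih.1⟩, ih.2⟩
  rw [memory, wellFormed_append, (hcycles _).2]
  exact ⟨(hcycles _).1, (wellFormed_meas (fun _ => b) (Sum.inl : _ → Wire n nx nz)
    (fun q => (Sum.inr q : Label n nx nz T)) Sum.inl_injective (List.finRange n)
    (List.nodup_finRange n) dataOnly (fun _ _ => rfl)).1⟩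

/-! ### The effect of losses on the data -/

theorem cycle_effect {σ : C.Schedule} {b : PauliType} {L : Finset (ℕ × Wire n nx nz)}
    {o : Label n nx nz T → ZMod 2} {c : Fin T} {t : ℕ}
    {s : Config (Wire n nx nz) (Label n nx nz T)} {x x' : Wire n nx nz → ZMod 2}
    {base : Fin n → ZMod 2} (hx : ∀ q, s.lost (Sum.inl q) = false → x (Sum.inl q) = base q)
    (hp : Path b L o t (cycle σ c) s x x') :
    ∃ err : Fin nx ⊕ Fin nz → Fin n → ZMod 2, ∃ g ∈ C.gauge b,
      (∀ q, (exec L o t (cycle σ c) s).lost (Sum.inl q) = false →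
        x' (Sum.inl q) = (base + (∑ a, err a + g)) q) ∧
      (∀ a, ∃ i ≤ C.reach b a, err a = C.initialSegment a i) ∧
      (∀ a, (exec L o t (cycle σ c) s).readout (Sum.inl (c, a)) = false → err a = 0) ∧
      ∀ κ, (∀ a, κ ≠ Sum.inl (c, a)) →
        (exec L o t (cycle σ c) s).readout κ = s.readout κ := by
  rw [cycle_eq] at hp ⊢
  rw [path_append] at hp
  obtain ⟨y, hp1, hp2⟩ := hp
  rw [path_append] at hp2
  obtain ⟨z, hp2, hp3⟩ := hp2
  rw [exec_append, exec_append]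
  obtain ⟨a1, a2, a3, a4⟩ := prep_phase _ hp1
  generalize exec L o t _ s = s₁ at *
  have hinv : C.PhaseInv b base 0 s₁.lost y := by
    refine ⟨0, fun q hq => ?_, fun a => ⟨Nat.zero_le _, fun _ => ⟨rfl, fun hb =>
      a2 a hb (Or.inl (mem_ancillas a))⟩, fun h => absurd h (lt_irrefl _)⟩⟩
    rw [a1, hx q]
    · simp
    · by_contra hne
      rw [a3 q (by simpa using hne)] at hq
      exact Bool.noConfusion hq
  obtain ⟨⟨P, hP1, hP2⟩, hr⟩ := hinv.gates _ σ.completes hp2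
  generalize exec L o _ _ s₁ = s₂ at *
  obtain ⟨m1, m2, m3, m4, m5⟩ := meas_phase kind Sum.inr
    (fun a => (Sum.inl (c, a) : Label n nx nz T)) Sum.inr_injective
    (fun a a' h => (Prod.mk.inj (Sum.inl.inj h)).2) _ nodup_ancillas hp3
  generalize exec L o _ _ s₂ = s₃ at *
  -- Effects of ancilla wires with a lost atom are errors; those of intact ones are complete, hence
  -- zero or multiples of stabilizers of the other type.
  refine ⟨fun a => if s₂.lost (Sum.inr a) = true then P a else 0,
    ∑ a, (if s₂.lost (Sum.inr a) = true then 0 else P a), ?_, fun q hq => ?_, fun a => ?_,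
    fun a ha => ?_, fun κ hκ => ?_⟩
  · refine Submodule.sum_mem _ fun a _ => ?_
    split_ifs with hl
    · exact Submodule.zero_mem _
    · rw [((hP2 a).2.2 (C.weight_pos a)).1 (by simpa using hl)]
      split_ifs with hb
      · exact Submodule.zero_mem _
      · rw [initialSegment_weight]
        exact Submodule.smul_mem _ _ (Submodule.subset_span ⟨a, hb, rfl⟩)
  · have hsum : ∑ a, P a = ∑ a, (if s₂.lost (Sum.inr a) = true then P a else 0) +
        ∑ a, (if s₂.lost (Sum.inr a) = true then 0 else P a) := by
      rw [← Finset.sum_add_distrib]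
      refine Finset.sum_congr rfl fun a _ => ?_
      split_ifs <;> simp
    rw [m1 _ (by simp), hP1 q, hsum]
    · by_contra hne
      rw [m3 _ (by simpa using hne)] at hq
      exact Bool.noConfusion hq
  · dsimp only
    split_ifs with hl
    · obtain ⟨i, -, hi, hv⟩ := ((hP2 a).2.2 (C.weight_pos a)).2 hl
      exact ⟨i, hi, hv⟩
    · exact ⟨0, Nat.zero_le _, (C.initialSegment_zero a).symm⟩
  · refine if_neg fun hl => ?_
    rw [m5 a (mem_ancillas a) hl] at ha
    exact Bool.noConfusion ha
  · rw [m4 κ fun a _ => hκ a, hr, a4]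

theorem cycles_effect {σ : C.Schedule} {b : PauliType} {L : Finset (ℕ × Wire n nx nz)}
    {o : Label n nx nz T → ZMod 2} (cs : List (Fin T)) (hcs : cs.Nodup) {t : ℕ}
    {s : Config (Wire n nx nz) (Label n nx nz T)} {x x' : Wire n nx nz → ZMod 2}
    {base : Fin n → ZMod 2} (hx : ∀ q, s.lost (Sum.inl q) = false → x (Sum.inl q) = base q)
    (hp : Path b L o t (cs.flatMap (cycle σ)) s x x') :
    ∃ err : Fin T → Fin nx ⊕ Fin nz → Fin n → ZMod 2, ∃ g ∈ C.gauge b,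
      (∀ q, (exec L o t (cs.flatMap (cycle σ)) s).lost (Sum.inl q) = false →
        x' (Sum.inl q) = (base + (∑ c, ∑ a, err c a + g)) q) ∧
      (∀ c a, ∃ i ≤ C.reach b a, err c a = C.initialSegment a i) ∧
      (∀ c, c ∉ cs → err c = 0) ∧
      (∀ c a, (exec L o t (cs.flatMap (cycle σ)) s).readout (Sum.inl (c, a)) = false →
        err c a = 0) ∧
      ∀ κ, (∀ c ∈ cs, ∀ a, κ ≠ Sum.inl (c, a)) →
        (exec L o t (cs.flatMap (cycle σ)) s).readout κ = s.readout κ := by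
  induction cs generalizing t s x base with
  | nil =>
    obtain rfl : x' = x := hp
    refine ⟨0, 0, Submodule.zero_mem _, fun q hq => ?_, fun c a =>
      ⟨0, Nat.zero_le _, (C.initialSegment_zero a).symm⟩, fun _ _ => rfl, fun _ _ _ => rfl,
      fun _ _ => rfl⟩
    rw [hx q hq]
    simp
  | cons c cs ih =>
    rw [List.nodup_cons] at hcs
    rw [List.flatMap_cons] at hp ⊢
    rw [path_append] at hp
    obtain ⟨y, hp1, hp2⟩ := hp
    rw [exec_append]
    obtain ⟨e₁, g₁, hg₁, h1, h2, h3, h4⟩ := cycle_effect hx hp1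
    obtain ⟨e₂, g₂, hg₂, k1, k2, k3, k4, k5⟩ := ih hcs.2 h1 hp2
    have hupd : Function.update e₂ c e₁ = Pi.single c e₁ + e₂ := by
      funext c'
      by_cases hc : c' = c
      · subst hc; simp [k3 _ hcs.1]
      · simp [hc]
    -- The final string of the first cycle is the reference word for the remaining ones, so errors
    -- add up; data losses still pending stay in the loss flags.
    refine ⟨Function.update e₂ c e₁, g₁ + g₂, Submodule.add_mem _ hg₁ hg₂, fun q hq => ?_,
      fun c' a => ?_, fun c' hc' => ?_, fun c' a hr => ?_, fun κ hκ => ?_⟩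
    · rw [k1 q hq]
      have hsum : ∑ c', ∑ a, Function.update e₂ c e₁ c' a =
          ∑ a, e₁ a + ∑ c', ∑ a, e₂ c' a := by
        rw [hupd]
        simp only [Pi.add_apply, Finset.sum_add_distrib]
        congr 1
        rw [Finset.sum_eq_single c]
        · simp
        · intro c' _ hc'; simp [hc']
        · simp
      rw [hsum]
      exact congrFun (by abel) q
    · by_cases hc : c' = c
      · subst hc; simpa using h2 a
      · simpa [hc] using k2 c' a
    · rw [List.mem_cons, not_or] at hc'
      rw [Function.update_of_ne hc'.1, k3 c' hc'.2]
    · by_cases hc : c' = c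
      · subst hc
        rw [Function.update_self]
        refine h3 a ?_
        rw [← hr]
        refine (k5 _ fun c'' hc'' a' h => ?_).symm
        exact hcs.1 ((Prod.mk.inj (Sum.inl.inj h)).1 ▸ hc'')
      · rw [Function.update_of_ne hc]
        exact k4 c' a hr
    · rw [k5 κ fun c' hc' => hκ c' (List.mem_cons_of_mem _ hc'), h4 κ (hκ c (by simp))]

/-- The possible effects on the data readout in basis `b` of the loss of the atom whose life ends
with the measurement `κ`. -/
def LossError (C : CSSCode n nx nz) (b : PauliType) (κ : Label n nx nz T)
    (v : Fin n → ZMod 2) : Prop :=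
  match κ with
  | .inl (_, a) => ∃ i ≤ C.reach b a, v = C.initialSegment a i
  | .inr q => ∃ z : ZMod 2, v = z • Pi.single q 1

theorem run_effect {σ : C.Schedule} {b : PauliType} {ψ : (Fin n → ZMod 2) → ℂ}
    {L : Finset (ℕ × Wire n nx nz)} {o : Label n nx nz T → ZMod 2}
    (h : (run σ b T ψ L o).amp ≠ 0) :
    ∃ x₀ : Wire n nx nz → ZMod 2, spectrum b (initial nx nz T ψ).amp x₀ ≠ 0 ∧
    ∃ err : Label n nx nz T → Fin n → ZMod 2, ∃ g ∈ C.gauge b,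
      (fun q => visible (run σ b T ψ L o).readout o (Sum.inr q)) =
        (fun q => x₀ (Sum.inl q)) + (∑ κ, err κ + g) ∧
      ∀ κ, C.LossError b κ (err κ) ∧ ((run σ b T ψ L o).readout κ = false → err κ = 0) := by
  obtain ⟨x', hx'⟩ := exists_spectrum_ne_zero b h
  have hempty : EmptyZero dataOnly (initial nx nz T ψ).amp := by
    intro x hx w hw
    cases w with
    | inl q => simp [dataOnly] at hw
    | inr a =>
      simp only [initial] at hx
      split_ifs at hx with hall
      · exact hall a
      · exact absurd rfl hx
  obtain ⟨x₀, hx₀, hp⟩ := exists_path b L o 0 _ hempty (wellFormed_memory σ b) hx'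
  refine ⟨x₀, hx₀, ?_⟩
  unfold run
  unfold memory at hp ⊢
  rw [path_append] at hp
  rw [exec_append]
  obtain ⟨y, hp1, hp2⟩ := hp
  obtain ⟨e, g, hg, h1, h2, -, h3, h4⟩ := cycles_effect (List.finRange T) (List.nodup_finRange T)
    (base := fun q => x₀ (Sum.inl q)) (fun _ _ => rfl) hp1
  generalize exec L o 0 _ _ = s at *
  obtain ⟨-, m2, -, m4, m5⟩ := meas_phase (fun _ => b) Sum.inl
    (fun q => (Sum.inr q : Label n nx nz T)) Sum.inl_injective Sum.inr_injective _
    (List.nodup_finRange n) hp2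
  generalize exec L o _ _ s = s' at *
  set w : Fin n → ZMod 2 := (fun q => x₀ (Sum.inl q)) + (∑ c, ∑ a, e c a + g) with hw
  refine ⟨Sum.elim (fun p => e p.1 p.2)
    -- A lost data atom reports `0`, so its error must cancel the expected bit `w q`.
    (fun q => (if s'.readout (Sum.inr q) = true then w q else 0) • Pi.single q 1),
    g, hg, ?_, fun κ => ?_⟩
  · have hdata : ∀ q, visible s'.readout o (Sum.inr q) =
        w q + if s'.readout (Sum.inr q) = true then w q else 0 := by
      intro q
      unfold visible
      split_ifs with hr
      · rw [CharTwo.add_self_eq_zero]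
      · rw [add_zero, ← m2 q (List.mem_finRange q) rfl]
        refine h1 q ?_
        by_contra hne
        exact hr (m5 q (List.mem_finRange q) (by simpa using hne))
    have hsum : ∑ q, (if s'.readout (Sum.inr q) = true then w q else 0) •
        (Pi.single q 1 : Fin n → ZMod 2) =
        fun q => if s'.readout (Sum.inr q) = true then w q else 0 := by
      funext q
      rw [Finset.sum_apply, Finset.sum_eq_single q]
      · simp
      · intro q' _ hq'; simp [hq'.symm]
      · simp
    rw [Fintype.sum_sum_type, Fintype.sum_prod_type]
    simp only [Sum.elim_inl, Sum.elim_inr]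
    rw [hsum]
    funext q
    rw [hdata q, hw]
    simp only [Pi.add_apply]
    ring
  · rcases κ with ⟨c, a⟩ | q
    · refine ⟨h2 c a, fun hr => h3 c a ?_⟩
      rw [← hr]
      exact (m4 _ (by simp)).symm
    · exact ⟨⟨_, rfl⟩, fun hr => by simp [hr]⟩

theorem card_readout_run_le (σ : C.Schedule) (b : PauliType) (ψ : (Fin n → ZMod 2) → ℂ)
    (L : Finset (ℕ × Wire n nx nz)) (o : Label n nx nz T → ZMod 2) :
    (Finset.univ.filter fun κ => (run σ b T ψ L o).readout κ = true).card ≤ L.card :=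
  card_readout_exec_le L o _ dataOnly (wellFormed_memory σ b) _ (fun _ => rfl) fun _ => rfl

/-! ### Values of stabilizers and logical operators -/

/-- An eigenvector of a type-`b` Pauli is supported, in the basis `b`, on strings of the parity
given by the eigenvalue. With `v = 0` this also covers the stabilizers. -/
theorem dotProduct_eq_of_eigenvector {b : PauliType} {ψ : (Fin n → ZMod 2) → ℂ}
    {u : Fin n → ZMod 2} {v : ZMod 2} (hψ : pauli b u ψ = sign v • ψ)
    {x₀ : Wire n nx nz → ZMod 2} (hx₀ : spectrum b (initial nx nz T ψ).amp x₀ ≠ 0) :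
    (u ⬝ᵥ fun q => x₀ (Sum.inl q)) = v := by
  cases b with
  | Z =>
    simp only [spectrum, initial] at hx₀
    split_ifs at hx₀ with hall
    · exact eq_of_sign_mul_eq hx₀ (congrFun hψ fun q => x₀ (Sum.inl q))
    · exact absurd rfl hx₀
  | X =>
    set u' : Wire n nx nz → ZMod 2 := Sum.elim u 0 with hu'
    have hdot : x₀ ⬝ᵥ u' = u ⬝ᵥ fun q => x₀ (Sum.inl q) := by
      simp [dotProduct, hu', Fintype.sum_sum_type, mul_comm]
    have htr : ∀ x, (initial nx nz T ψ).amp (x + u') = sign v * (initial nx nz T ψ).amp x := by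
      intro x
      simp only [initial, Pi.add_apply, hu', Sum.elim_inr, Pi.zero_apply, add_zero, Sum.elim_inl]
      split_ifs with hall
      · exact congrFun hψ fun q => x (Sum.inl q)
      · simp
    rw [← hdot]
    refine eq_of_sign_mul_eq hx₀ ?_
    simp only [spectrum, Finset.mul_sum]
    rw [← Equiv.sum_comp (Equiv.addRight u')]
    refine Finset.sum_congr rfl fun x _ => ?_
    rw [Equiv.coe_addRight, htr, dotProduct_add, sign_add]
    linear_combination (sign (x₀ ⬝ᵥ x) * sign v * (initial nx nz T ψ).amp x) *
      sign_mul_self (x₀ ⬝ᵥ u')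

theorem stab_dotProduct_stab {a a' : Fin nx ⊕ Fin nz} (h : kind a ≠ kind a') :
    C.stab a ⬝ᵥ C.stab a' = 0 := by
  rcases a with i | j <;> rcases a' with i' | j'
  · exact absurd rfl h
  · exact C.commute i j'
  · rw [dotProduct_comm]
    exact C.commute i' j
  · exact absurd rfl h

theorem dotProduct_eq_zero_of_mem_span {S : Set (Fin n → ZMod 2)} {u v : Fin n → ZMod 2}
    (hS : ∀ w ∈ S, u ⬝ᵥ w = 0) (hv : v ∈ Submodule.span (ZMod 2) S) : u ⬝ᵥ v = 0 := by
  induction hv using Submodule.span_induction with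
  | mem w hw => exact hS w hw
  | zero => exact dotProduct_zero _
  | add w w' _ _ h h' => rw [dotProduct_add, h, h', add_zero]
  | smul z w _ h => rw [dotProduct_smul, h, smul_zero]

/-! ### From loss errors to segment hooks. -/

theorem exists_first_eq (q : Fin n) : ∃ a, C.first a = q := by
  have hcard : Fintype.card (Fin nx ⊕ Fin nz) = Fintype.card (Fin n) := by
    simp [C.card_add]
  exact ((Fintype.bijective_iff_injective_and_card _).2 ⟨C.first_injective, hcard⟩).2 q

/-- The opposite Pauli type. -/
def dual : PauliType → PauliType
  | .X => .Z
  | .Z => .X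

theorem kind_eq_dual_iff {b : PauliType} {a : Fin nx ⊕ Fin nz} :
    kind a = dual b ↔ kind a ≠ b := by
  cases kind a <;> cases b <;> simp [dual]

theorem kind_ne_dual_iff {b : PauliType} {a : Fin nx ⊕ Fin nz} :
    kind a ≠ dual b ↔ kind a = b := by
  rw [ne_eq, kind_eq_dual_iff, not_not]

/-- The part of a vector on the qubits that carry a stabilizer of the type other than `b`. -/
noncomputable def restrict (C : CSSCode n nx nz) (b : PauliType) :
    (Fin n → ZMod 2) →+ (Fin n → ZMod 2) := by
  classical
  exact
  { toFun := fun v q => if ∃ a k, kind a ≠ b ∧ C.qubit a k = q then v q else 0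
    map_zero' := by funext q; simp
    map_add' := fun v w => by
      funext q
      simp only [Pi.add_apply]
      split_ifs <;> simp }

theorem restrict_apply_of_pos {b : PauliType} {q : Fin n}
    (h : ∃ a k, kind a ≠ b ∧ C.qubit a k = q) (v : Fin n → ZMod 2) :
    C.restrict b v q = v q := if_pos h

theorem restrict_apply_of_neg {b : PauliType} {q : Fin n}
    (h : ¬∃ a k, kind a ≠ b ∧ C.qubit a k = q) (v : Fin n → ZMod 2) :
    C.restrict b v q = 0 := if_neg h

theorem restrict_segmentHook {b : PauliType} {v : Fin n → ZMod 2}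
    (hv : C.IsSegmentHook (dual b) v) : C.restrict b v = v := by
  obtain ⟨a, j₁, j₂, ha, -, rfl⟩ := hv
  unfold qubitVec
  rw [map_sum]
  refine Finset.sum_congr rfl fun k _ => ?_
  funext q
  by_cases h : ∃ a k, kind a ≠ b ∧ C.qubit a k = q
  · exact restrict_apply_of_pos h _
  · rw [restrict_apply_of_neg h, Pi.single_eq_of_ne]
    rintro rfl
    exact h ⟨a, k, kind_eq_dual_iff.1 ha, rfl⟩

/-- A qubit of an opposite-type stabilizer is itself a segment of length one; other qubits are
erased. -/
theorem restrict_single {b : PauliType} (q : Fin n) (z : ZMod 2) :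
    C.restrict b (z • Pi.single q 1) = 0 ∨
      C.IsSegmentHook (dual b) (C.restrict b (z • Pi.single q 1)) := by
  by_cases h : ∃ a k, kind a ≠ b ∧ C.qubit a k = q
  · rcases zmod_two_cases z with rfl | rfl
    · left; simp
    · right
      obtain ⟨a, k, ha, rfl⟩ := h
      have hh : C.IsSegmentHook (dual b) ((1 : ZMod 2) • Pi.single (C.qubit a k) 1) :=
        ⟨a, k, k, kind_eq_dual_iff.2 ha, le_rfl, by simp [qubitVec]⟩
      rw [restrict_segmentHook hh]
      exact hh
  · left
    funext q'
    by_cases hq' : ∃ a k, kind a ≠ b ∧ C.qubit a k = q'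
    · have hne : q' ≠ q := fun he => h (he ▸ hq')
      rw [restrict_apply_of_pos hq']
      simp [hne]
    · exact restrict_apply_of_neg hq' _

theorem LossError.restrict_add {b : PauliType} {κ : Label n nx nz T} {v v' : Fin n → ZMod 2}
    (h : C.LossError b κ v) (h' : C.LossError b κ v') :
    C.restrict b (v + v') = 0 ∨ C.IsSegmentHook (dual b) (C.restrict b (v + v')) := by
  rcases κ with ⟨c, a⟩ | q
  · obtain ⟨i, hi, rfl⟩ := h
    obtain ⟨j, hj, rfl⟩ := h'
    by_cases hb : kind a = b
    · rw [reach, if_pos hb] at hi hj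
      have key : ∀ i ≤ 1, ∃ z : ZMod 2, C.initialSegment a i = z • Pi.single (C.first a) 1 := by
        intro i hi
        rcases Nat.le_one_iff_eq_zero_or_eq_one.mp hi with rfl | rfl
        · exact ⟨0, by rw [initialSegment_zero, zero_smul]⟩
        · exact ⟨1, by rw [initialSegment_one, one_smul]⟩
      obtain ⟨z, hz⟩ := key i hi
      obtain ⟨z', hz'⟩ := key j hj
      rw [hz, hz', ← add_smul]
      exact restrict_single _ _
    · rw [reach, if_neg hb] at hi hj
      have key : ∀ i j, i < j → j ≤ C.weight a → C.IsSegmentHook (dual b)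
          (C.restrict b (C.initialSegment a i + C.initialSegment a j)) := by
        intro i j hij hj
        have hh : C.IsSegmentHook (dual b) (C.initialSegment a i + C.initialSegment a j) :=
          ⟨a, ⟨i, by omega⟩, ⟨j - 1, by omega⟩, kind_eq_dual_iff.2 hb,
            by rw [Fin.mk_le_mk]; omega, C.initialSegment_add_of_lt a hij hj⟩
        rw [restrict_segmentHook hh]
        exact hh
      rcases lt_trichotomy i j with hij | rfl | hij
      · exact Or.inr (key i j hij hj)
      · left
        rw [ZModModule.add_self, map_zero]
      · rw [add_comm]
        exact Or.inr (key j i hij hi)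
  · obtain ⟨z, rfl⟩ := h
    obtain ⟨z', rfl⟩ := h'
    rw [← add_smul]
    exact restrict_single _ _

/-- On an erased qubit `q`, the type-`b` Pauli is a stabilizer, by the hypothesis applied to a
single hook. Since `E` commutes with it, `E q = 0`. -/
theorem restrict_eq_self {ds : ℕ} (hseg : C.SegmentHooksTrivial ds) (hds : 1 ≤ ds)
    {b : PauliType} {E : Fin n → ZMod 2} (hE : C.IsLogical (dual b) E) : C.restrict b E = E := by
  funext q
  by_cases h : ∃ a k, kind a ≠ b ∧ C.qubit a k = q
  · exact restrict_apply_of_pos h E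
  · rw [restrict_apply_of_neg h]
    obtain ⟨a, ha⟩ := C.exists_first_eq q
    have hb : kind a = b := by
      by_contra hne
      exact h ⟨a, _, hne, ha⟩
    have hhook : C.IsSegmentHook b (Pi.single q 1) :=
      ⟨a, ⟨0, C.weight_pos a⟩, ⟨0, C.weight_pos a⟩, hb, le_rfl, by
        rw [← ha]; simp [qubitVec, first]⟩
    have hlog : C.IsLogical b (Pi.single q 1) := by
      intro a' ha'
      rw [single_one_dotProduct, stab, qubitVec, Finset.sum_apply]
      refine Finset.sum_eq_zero fun k _ => Pi.single_eq_of_ne ?_ _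
      rintro rfl
      exact h ⟨a', k, ha', rfl⟩
    have hst := hseg b [Pi.single q 1] (by simpa using hds) (by simpa using hhook)
      (by simpa using hlog)
    have hdot := dotProduct_eq_zero_of_mem_span (u := E) ?_ hst
    · rw [List.sum_singleton, dotProduct_single_one] at hdot
      exact hdot.symm
    · rintro w ⟨a', ha', rfl⟩
      exact hE a' (kind_ne_dual_iff.2 ha')

theorem isStabilizer_of_lossErrors {ds : ℕ} (hseg : C.SegmentHooksTrivial ds) {b : PauliType}
    {lost : Label n nx nz T → Bool}
    (hcard : (Finset.univ.filter fun κ => lost κ = true).card ≤ ds)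
    {err err' : Label n nx nz T → Fin n → ZMod 2}
    (herr : ∀ κ, C.LossError b κ (err κ) ∧ (lost κ = false → err κ = 0))
    (herr' : ∀ κ, C.LossError b κ (err' κ) ∧ (lost κ = false → err' κ = 0))
    (hlog : C.IsLogical (dual b) (∑ κ, (err κ + err' κ))) :
    C.IsStabilizer (dual b) (∑ κ, (err κ + err' κ)) := by
  classical
  set S := Finset.univ.filter fun κ => lost κ = true with hS
  have hout : ∀ κ ∉ S, err κ + err' κ = 0 := by
    intro κ hκ
    have : lost κ = false := by simpa [hS] using hκ
    rw [(herr κ).2 this, (herr' κ).2 this, add_zero]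
  have hsum : ∑ κ ∈ S, (err κ + err' κ) = ∑ κ, (err κ + err' κ) :=
    Finset.sum_subset (Finset.subset_univ S) fun κ _ hκ => hout κ hκ
  -- `restrict_eq_self` needs `1 ≤ ds`; for `ds = 0` nothing is flagged and the sum is empty.
  rcases Nat.eq_zero_or_pos ds with rfl | hds
  · rw [← hsum, Finset.card_eq_zero.mp (Nat.le_zero.mp hcard), Finset.sum_empty]
    exact Submodule.zero_mem _
  -- Vanishing terms are dropped because an empty segment is not a segment hook.
  set S' := S.filter fun κ => C.restrict b (err κ + err' κ) ≠ 0 with hS'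
  have hsum' : (S'.toList.map fun κ => C.restrict b (err κ + err' κ)).sum =
      ∑ κ, (err κ + err' κ) := by
    rw [Finset.sum_map_toList, hS', Finset.sum_filter_ne_zero, ← map_sum, hsum]
    exact restrict_eq_self hseg hds hlog
  rw [← hsum']
  refine hseg _ _ ?_ ?_ (hsum' ▸ hlog)
  · rw [List.length_map, Finset.length_toList]
    exact (Finset.card_filter_le _ _).trans hcard
  · intro u hu
    obtain ⟨κ, hκ, rfl⟩ := List.mem_map.mp hu
    rw [Finset.mem_toList, hS', Finset.mem_filter] at hκ
    exact ((herr κ).1.restrict_add (herr' κ).1).resolve_left hκ.2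

/-! ### Comparison of two runs. -/

/-- Detectors are consecutive sums starting from the value `0`, so they telescope back to the
reported values. -/
theorem syndrome_eq_of_detectors_eq {b : PauliType} {y y' : Label n nx nz T → ZMod 2}
    (h : C.detectors b y = C.detectors b y') (a : Fin nx ⊕ Fin nz) :
    ∀ r ≤ T, syndrome y r a = syndrome y' r a
  | 0, _ => rfl
  | r + 1, hr => by
    have h1 := congrFun (congrFun (congrArg Prod.fst h) ⟨r, hr⟩) a
    simp only [detectors] at h1
    rw [syndrome_eq_of_detectors_eq h a r (Nat.le_of_succ_le hr)] at h1
    exact add_right_cancel h1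

theorem stab_dotProduct_eq_of_detectors_eq {b : PauliType} {y y' : Label n nx nz T → ZMod 2}
    (h : C.detectors b y = C.detectors b y') {a : Fin nx ⊕ Fin nz} (ha : kind a = b) :
    (C.stab a ⬝ᵥ fun q => y (Sum.inr q)) = C.stab a ⬝ᵥ fun q => y' (Sum.inr q) := by
  have h1 := congrFun (congrArg Prod.snd h) ⟨a, ha⟩
  simp only [detectors] at h1
  rw [syndrome_eq_of_detectors_eq h a T le_rfl] at h1
  exact add_right_cancel h1

/-- Two runs with the same detector pattern and the same loss-resolving readouts have the same
logical outcome. -/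
theorem observable_eq_of_detectors_eq {ds : ℕ} (hseg : C.SegmentHooksTrivial ds)
    {σ : C.Schedule} {b : PauliType} {ψ ψ' : (Fin n → ZMod 2) → ℂ} (hψ : C.IsCodeState ψ)
    (hψ' : C.IsCodeState ψ') {L L' : Finset (ℕ × Wire n nx nz)} (hL : L.card ≤ ds)
    {o o' : Label n nx nz T → ZMod 2} (ho : (run σ b T ψ L o).amp ≠ 0)
    (ho' : (run σ b T ψ' L' o').amp ≠ 0) {u : Fin n → ZMod 2} {v v' : ZMod 2}
    (hu : C.IsLogical b u) (huv : pauli b u ψ = sign v • ψ) (huv' : pauli b u ψ' = sign v' • ψ')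
    (hread : (run σ b T ψ L o).readout = (run σ b T ψ' L' o').readout)
    (hdet : C.detectors b (visible (run σ b T ψ L o).readout o) =
      C.detectors b (visible (run σ b T ψ' L' o').readout o')) :
    observable (visible (run σ b T ψ L o).readout o) u + v =
      observable (visible (run σ b T ψ' L' o').readout o') u + v' := by
  obtain ⟨x, hx, err, g, hg, hy, herr⟩ := run_effect ho
  obtain ⟨x', hx', err', g', hg', hy', herr'⟩ := run_effect ho'
  have hcard := (card_readout_run_le σ b ψ L o).trans hL
  rw [← hread] at herr'
  have hcode : ∀ a, kind a = b → (C.stab a ⬝ᵥ fun q => x (Sum.inl q)) = 0 ∧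
      (C.stab a ⬝ᵥ fun q => x' (Sum.inl q)) = 0 := by
    intro a ha
    subst ha
    exact ⟨dotProduct_eq_of_eigenvector (by rw [hψ a, sign_zero, one_smul]) hx,
      dotProduct_eq_of_eigenvector (by rw [hψ' a, sign_zero, one_smul]) hx'⟩
  have hgauge : ∀ {w : Fin n → ZMod 2}, C.IsLogical b w → ∀ g ∈ C.gauge b, w ⬝ᵥ g = 0 := by
    intro w hw g hg
    refine dotProduct_eq_zero_of_mem_span ?_ hg
    rintro _ ⟨a, ha, rfl⟩
    exact hw a ha
  -- Code strings and opposite-type stabilizers have zero parity with type-`b` stabilizers, so equal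
  -- final syndromes leave only the errors.
  have hlog : C.IsLogical (dual b) (∑ κ, (err κ + err' κ)) := by
    intro a ha
    rw [kind_ne_dual_iff] at ha
    have h1 := stab_dotProduct_eq_of_detectors_eq hdet ha
    have hst : C.IsLogical b (C.stab a) := fun a' ha' =>
      stab_dotProduct_stab (by rw [ha]; exact ha'.symm)
    rw [hy, hy', dotProduct_add, dotProduct_add, dotProduct_add, dotProduct_add, (hcode a ha).1,
      (hcode a ha).2, hgauge hst g hg, hgauge hst g' hg', zero_add, zero_add, add_zero,
      add_zero] at h1
    rw [dotProduct_comm, Finset.sum_add_distrib, dotProduct_add, h1, CharTwo.add_self_eq_zero]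
  have hE : u ⬝ᵥ ∑ κ, (err κ + err' κ) = 0 := by
    refine dotProduct_eq_zero_of_mem_span ?_
      (isStabilizer_of_lossErrors hseg hcard herr herr' hlog)
    rintro _ ⟨a, ha, rfl⟩
    exact hu a (kind_eq_dual_iff.1 ha)
  rw [Finset.sum_add_distrib, dotProduct_add] at hE
  unfold observable
  rw [hy, hy', dotProduct_add, dotProduct_add, dotProduct_add, dotProduct_add,
    hgauge hu g hg, hgauge hu g' hg', dotProduct_eq_of_eigenvector huv hx,
    dotProduct_eq_of_eigenvector huv' hx', CharTwo.add_eq_zero.mp hE]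
  rw [add_zero, add_right_comm, CharTwo.add_self_eq_zero, add_right_comm,
    CharTwo.add_self_eq_zero]

end CSSCode
end MidSwap

/-! ### The decoder. -/

theorem mainTheorem11 {n nx nz : ℕ} (C : MidSwap.CSSCode n nx nz) (ds : ℕ)
    (hseg : C.SegmentHooksTrivial ds)
    (σ : C.Schedule) (b : MidSwap.PauliType) (T : ℕ) :
    MidSwap.CSSCode.CorrectsLosses σ b T ds := by
  classical
  open MidSwap MidSwap.CSSCode in
  let Consistent (p : Pattern nx nz T b) (r : Label n nx nz T → Bool) (u : Fin n → ZMod 2)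
      (z : ZMod 2) : Prop :=
    ∃ ψ, C.IsCodeState ψ ∧ ∃ L : Finset (ℕ × Wire n nx nz), L.card ≤ ds ∧
    ∃ o : Label n nx nz T → ZMod 2, (run σ b T ψ L o).amp ≠ 0 ∧
    ∃ v : ZMod 2, C.IsLogical b u ∧ pauli b u ψ = sign v • ψ ∧
      (run σ b T ψ L o).readout = r ∧
      C.detectors b (visible (run σ b T ψ L o).readout o) = p ∧
      z = observable (visible (run σ b T ψ L o).readout o) u + v
  -- The decoder returns any value attained by some admissible run with this input; all such values
  -- agree. The default `0` is used only for inputs that no such run produces.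
  refine ⟨fun p r u => if h : ∃ z, Consistent p r u z then h.choose else 0, ?_⟩
  intro ψ hψ L hL o ho u v hu huv r y
  have h : ∃ z, Consistent (C.detectors b y) r u z :=
    ⟨_, ψ, hψ, L, hL, o, ho, v, hu, huv, rfl, rfl, rfl⟩
  simp only [dif_pos h]
  obtain ⟨ψ', hψ', L', hL', o', ho', v', -, huv', hr, hd, hz⟩ := h.choose_spec
  rw [hz]
  exact MidSwap.CSSCode.observable_eq_of_detectors_eq hseg hψ' hψ hL' ho' ho hu huv' huv hr hd
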